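/- A digraph is a finite directed multigraph, in which parallel edges and loops are allowed. A closed trail is a closed directed walk $\mathbf w=(v_0,e_1,v_1,\dots,e_d,v_d)$ with $d\ge 1$, $v_d=v_0$ and pairwise distinct edges; it is Eulerian if it traverses every edge. A circuit is a class of closed trails up to cyclic permutation, and an Eulerian circuit is the class of an Eulerian closed trail; a digraph is Eulerian if it has an Eulerian circuit. A cycle is a circuit with no repeated vertex (a loop is a cycle of length $1$); $\mathcal B(D)$ is the set of cycles of $D$. Let $\mathcal S$ (the bridgeless cactus digraphs) be the closure of the set of all cycles under the partial operation $D_1\ast D_2$, the union of two digraphs having exactly one vertex in common. A block of $D$ is a maximal biconnected subdigraph, where a subdigraph is biconnected if it is connected and its edges cannot be split into two nonempty parts having at most one vertex in common (thus a loop is a block by itself). The intersection graph $G_{\mathcal B(D)}$ has vertex set $\mathcal B(D)$, two distinct cycles being adjacent if they share a vertex. A pair $(a,b)$ of vertices, possibly $a=b$, is an interlacing pair of a closed trail $\mathbf w$ if there are indices $0\le i_1<i_2<i_3<i_4\le d$ with $v_{i_1}=v_{i_3}=a$, $v_{i_2}=v_{i_4}=b$ and $v_j\notin\{a,b\}$ for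 all other $j$ with $i_1<j<i_4$; it is an interlacing pair of a circuit if it is one of some closed trail representing that circuit. **Proposition.** Let $D$ be a digraph with at least one edge and without isolated vertices. Then the following conditions (1), (2), (4), (5) are equivalent, and if $D$ is Eulerian, then all of (1)–(5) are equivalent: 1. $D\in\mathcal S$ and the maximum out-degree satisfies $\Delta^+(D)\le 2$. 2. $D\in\mathcal S$ and each vertex lies in at most two blocks, i.e. $D$ is a bridgeless Christmas cactus digraph. 3. The intersection graph $G_{\mathcal B(D)}$ is a tree. 4. $D$ has a unique Eulerian circuit. 5. $D$ has an Eulerian circuit with no interlacing pair. -/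

import Mathlib

/-- A directed multigraph with vertex set `V` and edge set `E`; the edge `e` goes from `src e`
to `tgt e`. Parallel edges and loops are allowed. -/
structure MultiDigraph (V E : Type*) where
  src : E → V
  tgt : E → V

namespace MultiDigraph

variable {V E : Type*} (D : MultiDigraph V E)

/-- The out-degree of a vertex: the number of edges leaving it (a loop counts once). -/
noncomputable def outDegree (v : V) : ℕ := {e : E | D.src e = v}.ncard

/-- The maximum out-degree (used for digraphs with finitely many vertices). -/
noncomputable def maxOutDegree : ℕ := ⨆ v : V, D.outDegree v

/-- The set of end vertices of a set of edges. A subdigraph without isolated vertices is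
identified with its edge set `F`, and then this is its vertex set. -/
def vertsOf (F : Set E) : Set V := {v | ∃ e ∈ F, D.src e = v ∨ D.tgt e = v}

/-- `w = [e₁, …, e_d]` (`d ≥ 1`) is the edge sequence of a closed trail: the edges are pairwise
distinct, each `e_{i+1}` starts where `e_i` ends, and `e₁` starts where `e_d` ends. -/
def IsClosedTrail (w : List E) : Prop :=
  w ≠ [] ∧ w.Nodup ∧ Cycle.Chain (fun e f => D.tgt e = D.src f) (w : Cycle E)

/-- The sequence `v₀, v₁, …, v_d` of vertices visited by a walk with edge sequence
`e₁, …, e_d`. -/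
def vertexSeq : List E → List V
  | [] => []
  | e :: l => D.src e :: (e :: l).map D.tgt

/-- A closed trail is Eulerian if it traverses every edge. -/
def IsEulerianTrail (w : List E) : Prop := D.IsClosedTrail w ∧ ∀ e : E, e ∈ w

/-- Eulerian circuits: classes of Eulerian closed trails up to cyclic permutation
(`Cycle E` is the type of lists over `E` up to rotation). -/
def eulerianCircuits : Set (Cycle E) :=
  {z | ∃ w : List E, D.IsEulerianTrail w ∧ (w : Cycle E) = z}

/-- A digraph is Eulerian if it has an Eulerian circuit. -/
def IsEulerian : Prop := D.eulerianCircuits.Nonempty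

/-- The (directed) cycles: classes, up to cyclic permutation, of closed trails
`(v₀, e₁, …, e_d, v_d = v₀)` for which `v₀, …, v_{d-1}` are pairwise distinct.
A loop is a cycle of length one. -/
def cycles : Set (Cycle E) :=
  {z | ∃ w : List E, D.IsClosedTrail w ∧ (w.map D.src).Nodup ∧ (w : Cycle E) = z}

/-- The vertex set of a circuit. -/
def circuitVerts (z : Cycle E) : Set V := D.vertsOf {e | e ∈ z}

/-- The intersection graph of the set of cycles: two distinct cycles are adjacent if they have
a common vertex. -/
def cycleIntersectionGraph : SimpleGraph D.cycles where
  Adj β γ := β ≠ γ ∧ (D.circuitVerts β.1 ∩ D.circuitVerts γ.1).Nonempty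
  symm := ⟨fun _ _ h => ⟨h.1.symm, by rw [Set.inter_comm]; exact h.2⟩⟩
  loopless := ⟨fun _ h => h.1 rfl⟩

/-- The subdigraphs (given by their edge sets) in the closure of the set of all cycles under
`D₁ ∗ D₂`, which is the union of `D₁` and `D₂` and is defined only if they have exactly one
common vertex. -/
inductive InCycleClosure : Set E → Prop
  | cycle (z : Cycle E) (hz : z ∈ D.cycles) : InCycleClosure {e | e ∈ z}
  | ast (F₁ F₂ : Set E) (u : V) (h₁ : InCycleClosure F₁) (h₂ : InCycleClosure F₂)
      (h : D.vertsOf F₁ ∩ D.vertsOf F₂ = {u}) : InCycleClosure (F₁ ∪ F₂)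

/-- Membership in the family `𝒮` of bridgeless cactus digraphs: `D` itself is obtained from
cycles by the operation `∗`. -/
def IsBridgelessCactus : Prop :=
  D.InCycleClosure Set.univ ∧ D.vertsOf Set.univ = Set.univ

/-- A subdigraph (given by a nonempty edge set `F`) is biconnected if the removal of a vertex does
not disconnect it (and it is connected): one cannot split its edges into two nonempty parts which
meet in at most one vertex `v`. Edges at `v` are kept as open arcs, so that a vertex carrying
a loop and a further edge separates the loop from that edge, and a single loop is biconnected. -/
def IsBiconnected (F : Set E) : Prop :=
  F.Nonempty ∧ ∀ (v : V) (F₁ F₂ : Set E), F₁.Nonempty → F₂.Nonempty → Disjoint F₁ F₂ →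
    F₁ ∪ F₂ = F → ¬ D.vertsOf F₁ ∩ D.vertsOf F₂ ⊆ {v}

/-- A block is a maximal biconnected subdigraph (in a digraph without isolated vertices). -/
def IsBlock (F : Set E) : Prop := Maximal D.IsBiconnected F

/-- A bridgeless Christmas cactus: a bridgeless cactus digraph in which every vertex lies in at
most two blocks. -/
def IsBridgelessChristmasCactus : Prop :=
  D.IsBridgelessCactus ∧ ∀ v : V, {F : Set E | D.IsBlock F ∧ v ∈ D.vertsOf F}.encard ≤ 2

/-- `(a, b)` is an interlacing pair of the closed trail `w` with vertices `v₀, …, v_d`: there are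
`0 ≤ i₁ < i₂ < i₃ < i₄ ≤ d` at which `w` visits `a, b, a, b`, and `w` visits neither `a` nor `b` at
any other index between `i₁` and `i₄`. (The case `a = b` is allowed.) -/
def IsInterlacingPairOfTrail (w : List E) (a b : V) : Prop :=
  ∃ i₁ i₂ i₃ i₄ : ℕ, i₁ < i₂ ∧ i₂ < i₃ ∧ i₃ < i₄ ∧
    (D.vertexSeq w)[i₁]? = some a ∧ (D.vertexSeq w)[i₂]? = some b ∧
    (D.vertexSeq w)[i₃]? = some a ∧ (D.vertexSeq w)[i₄]? = some b ∧
    ∀ j : ℕ, i₁ < j → j < i₄ → j ≠ i₂ → j ≠ i₃ →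
      (D.vertexSeq w)[j]? ≠ some a ∧ (D.vertexSeq w)[j]? ≠ some b

/-- `(a, b)` is an interlacing pair of a circuit if it is one of some closed trail representing
the circuit. -/
def IsInterlacingPair (z : Cycle E) (a b : V) : Prop :=
  ∃ w : List E, D.IsClosedTrail w ∧ (w : Cycle E) = z ∧ D.IsInterlacingPairOfTrail w a b

end MultiDigraph

/-! Everything is compared with one property of an Eulerian closed trail, `IsTreelike`: in its
cyclic sequence of sources no vertex occurs three times and no two vertices alternate as a, b, a, b.

If such a trail repeats a vertex, it contains a simple closed subwalk, and noncrossing makes this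
subwalk meet the rest of the trail in its base vertex only (`IsWalk.exists_noncrossing_split`).
Induction on the length then gives the cactus structure (`inCycleClosure_of_noncrossing`),
uniqueness up to rotation (`IsTreelike.isRotated_of_perm`) and the tree (`IsTreelike.isTree`, where
the split-off cycle is a leaf). Conversely, trails of two parts glued at a vertex are concatenated
there without creating a crossing (`InCycleClosure.exists_noncrossing`), and the out-degree bounds
the number of visits.

The other conditions lead back to treelike trails as follows. An interlacing pair allows two
segments of the trail to be exchanged, which yields a second Eulerian circuit
(`IsInterlacingPairOfTrail.exists_ne`), so uniqueness excludes such pairs. A vertex visited three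
times, or a crossing, yields an interlacing pair; it also yields three distinct cycles through one
vertex, a triangle in the intersection graph. Finally, the blocks of a cactus are its cycles, and
each cycle through a vertex uses one edge leaving it, so the block bound is the out-degree bound
(`christmasCactus_iff`).

Condition (3) needs an Eulerian trail as a hypothesis because the intersection graph does not see
edges that lie on no cycle. -/

namespace MultiDigraph

/-! ### Walks, rotation of closed trails, extraction of simple closed walks. -/

variable {V E : Type*} (D : MultiDigraph V E)

/-- `D.IsWalk a w b`: the edge sequence `w` is a directed walk from `a` to `b`. -/
def IsWalk : V → List E → V → Prop
  | a, [], b => a = b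
  | a, e :: l, b => D.src e = a ∧ IsWalk (D.tgt e) l b

variable {D}

theorem IsWalk.append {a b c : V} {l₁ l₂ : List E} (h₁ : D.IsWalk a l₁ b) (h₂ : D.IsWalk b l₂ c) :
    D.IsWalk a (l₁ ++ l₂) c := by
  induction l₁ generalizing a with
  | nil => cases h₁; exact h₂
  | cons e l ih => exact ⟨h₁.1, ih h₁.2⟩

theorem isWalk_append_iff {a c : V} {l₁ l₂ : List E} :
    D.IsWalk a (l₁ ++ l₂) c ↔ ∃ b, D.IsWalk a l₁ b ∧ D.IsWalk b l₂ c := by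
  refine ⟨fun h => ?_, fun ⟨b, h₁, h₂⟩ => h₁.append h₂⟩
  induction l₁ generalizing a with
  | nil => exact ⟨a, rfl, h⟩
  | cons e l ih =>
    obtain ⟨b, h₁, h₂⟩ := ih h.2
    exact ⟨b, ⟨h.1, h₁⟩, h₂⟩

theorem IsWalk.end_unique {a b c : V} {l : List E} (h : D.IsWalk a l b) (h' : D.IsWalk a l c) :
    b = c := by
  induction l generalizing a with
  | nil => exact h.symm.trans h'
  | cons e l ih => exact ih h.2 h'.2

theorem IsWalk.filter {a b : V} {l : List E} (h : D.IsWalk a l b) (p : E → Bool)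
    (hp : ∀ e ∈ l, p e = false → D.src e = D.tgt e) : D.IsWalk a (l.filter p) b := by
  induction l generalizing a with
  | nil => exact h
  | cons e l ih =>
    have := ih h.2 (fun f hf => hp f (List.mem_cons_of_mem _ hf))
    by_cases he : p e = true
    · rw [List.filter_cons_of_pos he]
      exact ⟨h.1, this⟩
    · rw [List.filter_cons_of_neg he]
      rw [← h.1, hp e List.mem_cons_self (by simpa using he)]
      exact this

theorem isChain_iff_isWalk {e f : E} {l : List E} :
    List.IsChain (fun e f => D.tgt e = D.src f) (e :: (l ++ [f])) ↔
      D.IsWalk (D.src e) (e :: l) (D.src f) := by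
  induction l generalizing e with
  | nil => simp [IsWalk]
  | cons g l ih =>
    rw [List.cons_append, List.isChain_cons_cons, ih]
    constructor
    · rintro ⟨h, h'⟩
      exact ⟨rfl, h.symm, h'.2⟩
    · rintro ⟨-, h, h'⟩
      exact ⟨h.symm, rfl, h'⟩

theorem isClosedTrail_iff {w : List E} :
    D.IsClosedTrail w ↔ w ≠ [] ∧ w.Nodup ∧ ∃ a, D.IsWalk a w a := by
  refine and_congr_right fun hw => and_congr_right fun _ => ?_
  obtain ⟨e, l, rfl⟩ := List.exists_cons_of_ne_nil hw
  rw [Cycle.chain_coe_cons, isChain_iff_isWalk]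
  refine ⟨fun h => ⟨_, h⟩, fun ⟨a, h⟩ => ?_⟩
  rw [h.1]
  exact h

theorem IsClosedTrail.of_isRotated {w w' : List E} (h : D.IsClosedTrail w) (hr : w ~r w') :
    D.IsClosedTrail w' := by
  refine ⟨fun h0 => h.1 ?_, hr.nodup_iff.1 h.2.1, ?_⟩
  · subst h0
    exact List.isRotated_nil_iff.1 hr
  · have : (w : Cycle E) = w' := Cycle.coe_eq_coe.2 hr
    rw [← this]
    exact h.2.2

/-- A closed trail can be rotated so that it starts at any of its vertices. -/
theorem IsClosedTrail.exists_rotation {w : List E} (h : D.IsClosedTrail w) {e : E} (he : e ∈ w) :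
    ∃ l, w ~r (e :: l) ∧ D.IsWalk (D.src e) (e :: l) (D.src e) := by
  obtain ⟨s, t, rfl⟩ := List.append_of_mem he
  have hr : (s ++ e :: t) ~r (e :: (t ++ s)) := List.isRotated_append
  refine ⟨t ++ s, hr, ?_⟩
  obtain ⟨a, ha⟩ := (isClosedTrail_iff.1 (h.of_isRotated hr)).2.2
  have := ha.1
  subst this
  exact ha

theorem IsWalk.tgt_mem {a b : V} {l : List E} (h : D.IsWalk a l b) {e : E} (he : e ∈ l) :
    D.tgt e = b ∨ D.tgt e ∈ l.map D.src := by
  induction l generalizing a with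
  | nil => simp at he
  | cons f l ih =>
    rcases List.mem_cons.1 he with rfl | he
    · cases l with
      | nil => exact Or.inl h.2
      | cons g l => exact Or.inr (by simp [h.2.1])
    · rcases ih h.2 he with h' | h'
      · exact Or.inl h'
      · exact Or.inr (List.mem_cons_of_mem _ h')

theorem IsWalk.start_mem {a b : V} {l : List E} (h : D.IsWalk a l b) (hl : l ≠ []) :
    a ∈ l.map D.src := by
  cases l with
  | nil => exact absurd rfl hl
  | cons e l => simp [h.1]

theorem IsWalk.exists_tgt_eq_end {a b : V} {l : List E} (h : D.IsWalk a l b) (hl : l ≠ []) :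
    ∃ e ∈ l, D.tgt e = b := by
  induction l generalizing a with
  | nil => exact absurd rfl hl
  | cons e l ih =>
    cases l with
    | nil => exact ⟨e, by simp, h.2⟩
    | cons f l =>
      obtain ⟨g, hg, hg'⟩ := ih h.2 (by simp)
      exact ⟨g, List.mem_cons_of_mem _ hg, hg'⟩

theorem IsClosedTrail.tgt_mem {w : List E} (h : D.IsClosedTrail w) {e : E} (he : e ∈ w) :
    D.tgt e ∈ w.map D.src := by
  obtain ⟨hw, -, a, ha⟩ := isClosedTrail_iff.1 h
  rcases ha.tgt_mem he with h' | h'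
  · rw [h']
    exact ha.start_mem hw
  · exact h'

theorem IsClosedTrail.vertsOf_eq {w : List E} (h : D.IsClosedTrail w) :
    D.vertsOf {e | e ∈ w} = {v | v ∈ w.map D.src} := by
  ext v
  constructor
  · rintro ⟨e, he, rfl | rfl⟩
    · exact List.mem_map_of_mem he
    · exact h.tgt_mem he
  · intro hv
    obtain ⟨e, he, rfl⟩ := List.mem_map.1 hv
    exact ⟨e, he, Or.inl rfl⟩

/-- A set of edges of a closed trail which contains one of them and with each edge also all
possible successors contains the whole trail. -/
theorem IsClosedTrail.forall_of_succ {w : List E} (h : D.IsClosedTrail w) {P : E → Prop}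
    {e : E} (he : e ∈ w) (hP : P e)
    (hs : ∀ f ∈ w, ∀ g ∈ w, D.tgt f = D.src g → P f → P g) : ∀ f ∈ w, P f := by
  obtain ⟨l, hr, hl⟩ := h.exists_rotation he
  have key : ∀ (l : List E) (f : E) (b : V), f ∈ w → P f → (∀ g ∈ l, g ∈ w) →
      D.IsWalk (D.tgt f) l b → ∀ g ∈ l, P g := by
    intro l
    induction l with
    | nil => simp
    | cons k l ih =>
      intro f b hf hPf hlw hwalk
      have hk : P k := hs f hf k (hlw k (by simp)) hwalk.1.symm hPf
      intro g hg
      rcases List.mem_cons.1 hg with rfl | hg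
      · exact hk
      · exact ih k b (hlw k (by simp)) hk (fun g hg => hlw g (by simp [hg])) hwalk.2 g hg
  intro f hf
  rcases List.mem_cons.1 (hr.mem_iff.1 hf) with rfl | hf
  · exact hP
  · exact key l e _ he hP (fun g hg => hr.mem_iff.2 (by simp [hg])) hl.2 f hf

theorem vertsOf_mono {F G : Set E} (h : F ⊆ G) : D.vertsOf F ⊆ D.vertsOf G :=
  fun _ ⟨e, he, h'⟩ => ⟨e, h he, h'⟩

theorem src_mem_vertsOf {F : Set E} {e : E} (h : e ∈ F) : D.src e ∈ D.vertsOf F :=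
  ⟨e, h, Or.inl rfl⟩

theorem tgt_mem_vertsOf {F : Set E} {e : E} (h : e ∈ F) : D.tgt e ∈ D.vertsOf F :=
  ⟨e, h, Or.inr rfl⟩

/-- A walk through a repeated vertex contains a simple closed walk. -/
theorem IsWalk.exists_split {a b : V} {l : List E} (h : D.IsWalk a l b)
    (hn : ¬ (l.map D.src).Nodup) :
    ∃ p β f q u, l = p ++ (β ++ f :: q) ∧ β ≠ [] ∧ D.IsWalk a p u ∧ D.IsWalk u β u ∧
      D.IsWalk u (f :: q) b ∧ (β.map D.src).Nodup := by
  induction l generalizing a with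
  | nil => simp at hn
  | cons e l ih =>
    -- If the tail is simple, `e` is the last edge whose source recurs later, so the stretch from
    -- `e` to that recurrence is a simple closed walk.
    by_cases hl : (l.map D.src).Nodup
    · have hmem : D.src e ∈ l.map D.src := by
        by_contra hc
        exact hn (by rw [List.map_cons, List.nodup_cons]; exact ⟨hc, hl⟩)
      obtain ⟨f, hf, hfe⟩ := List.mem_map.1 hmem
      obtain ⟨s, t, rfl⟩ := List.append_of_mem hf
      obtain ⟨c, hc₁, hc₂⟩ := isWalk_append_iff.1 h.2
      have hc : c = D.src e := by rw [← hc₂.1, hfe]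
      subst hc
      refine ⟨[], e :: s, f, t, D.src e, by simp, by simp, h.1.symm, ⟨rfl, hc₁⟩, hc₂, ?_⟩
      rw [List.map_append, List.map_cons, List.nodup_append] at hl
      rw [List.map_cons, List.nodup_cons]
      refine ⟨fun h' => ?_, hl.1⟩
      exact hl.2.2 _ h' _ List.mem_cons_self hfe.symm
    · obtain ⟨p, β, f, q, u, rfl, h1, h2, h3, h4, h5⟩ := ih h.2 hl
      exact ⟨e :: p, β, f, q, u, rfl, h1, ⟨h.1, h2⟩, h3, h4, h5⟩

/-- A nonempty closed walk contains a simple closed walk through its starting vertex. -/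
theorem IsWalk.exists_cycle {a : V} {l : List E} (h : D.IsWalk a l a) (hl : l ≠ []) :
    ∃ c : List E, c.Sublist l ∧ c ≠ [] ∧ D.IsWalk a c a ∧ (c.map D.src).Nodup := by
  induction hn : l.length using Nat.strong_induction_on generalizing l with
  | _ n ih =>
    by_cases hd : (l.map D.src).Nodup
    · exact ⟨l, List.Sublist.refl _, hl, h, hd⟩
    · obtain ⟨p, β, f, q, u, rfl, h1, h2, h3, h4, h5⟩ := h.exists_split hd
      have hlen : 0 < β.length := List.length_pos_iff.2 h1
      obtain ⟨c, hc, h'⟩ := ih (p ++ f :: q).length (by simp at hn ⊢; omega) (h2.append h4)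
        (by simp) rfl
      refine ⟨c, hc.trans ?_, h'⟩
      exact (List.Sublist.refl p).append (List.sublist_append_right _ _)

theorem mem_cycles_of_isWalk {a : V} {c : List E} (hc : c ≠ []) (h : D.IsWalk a c a)
    (hn : (c.map D.src).Nodup) : (c : Cycle E) ∈ D.cycles :=
  ⟨c, isClosedTrail_iff.2 ⟨hc, hn.of_map, a, h⟩, hn, rfl⟩

/-- Without repetitions, the position of `x` determines the rotation. This turns equality of
circuits into equality of lists. -/
theorem eq_of_isRotated_of_head {α : Type*} {x : α} {l l' : List α} (hl : (x :: l).Nodup)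
    (h : (x :: l) ~r (x :: l')) : l = l' := by
  obtain ⟨n, hn, h⟩ := List.isRotated_iff_mod.1 h
  rw [List.rotate_eq_drop_append_take hn] at h
  rcases Nat.eq_zero_or_pos n with rfl | hpos
  · simpa using h
  · obtain ⟨m, rfl⟩ := Nat.exists_eq_succ_of_ne_zero hpos.ne'
    rw [List.drop_succ_cons, List.take_succ_cons] at h
    cases hd : l.drop m with
    | nil =>
      rw [hd] at h
      have hm : l.length ≤ m := List.drop_eq_nil_iff.1 hd
      rw [List.take_of_length_le hm] at h
      simpa using h
    | cons y t =>
      rw [hd] at h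
      have hxy : y = x := by simpa using (List.cons.inj h).1
      have : y ∈ l := List.mem_of_mem_drop (hd ▸ List.mem_cons_self)
      exact absurd (hxy ▸ this) (List.nodup_cons.1 hl).1

end MultiDigraph

/-! ### Noncrossing lists and lists with at most two occurrences of each entry. -/

namespace MultiDigraph

variable {V E : Type*} {D : MultiDigraph V E}

/-- No two distinct entries alternate as `a, b, a, b` in the list. -/
def Noncrossing {α : Type*} (l : List α) : Prop :=
  ∀ a b, a ≠ b → ¬ [a, b, a, b].Sublist l

/-- No entry occurs three times in the list. -/
def AtMostTwice {α : Type*} (l : List α) : Prop := ∀ a, ¬ [a, a, a].Sublist l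

section Lists

variable {α : Type*} {l l' : List α}

theorem Noncrossing.sublist (h : Noncrossing l) (hs : l'.Sublist l) : Noncrossing l' :=
  fun a b hab h' => h a b hab (h'.trans hs)

theorem AtMostTwice.sublist (h : AtMostTwice l) (hs : l'.Sublist l) : AtMostTwice l' :=
  fun a h' => h a (h'.trans hs)

theorem noncrossing_of_nodup (h : l.Nodup) : Noncrossing l := fun a b _ h' => by
  simpa using h.sublist h'

theorem atMostTwice_of_nodup (h : l.Nodup) : AtMostTwice l := fun a h' => by
  simpa using h.sublist h'

theorem atMostTwice_iff_count [DecidableEq α] : AtMostTwice l ↔ ∀ a, l.count a ≤ 2 := by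
  refine forall_congr' fun a => ?_
  have : [a, a, a] = List.replicate 3 a := rfl
  rw [this, List.replicate_sublist_iff]
  omega

theorem AtMostTwice.of_perm (h : AtMostTwice l) (hp : l.Perm l') : AtMostTwice l' := by
  classical
  rw [atMostTwice_iff_count] at *
  exact fun a => hp.count_eq a ▸ h a

theorem sublist_append_cases {x y z t : α} {l₁ l₂ : List α}
    (h : [x, y, z, t].Sublist (l₁ ++ l₂)) :
    [x, y, z, t].Sublist l₂ ∨ (x ∈ l₁ ∧ [y, z, t].Sublist l₂) ∨
      ([x, y].Sublist l₁ ∧ [z, t].Sublist l₂) ∨ ([x, y, z].Sublist l₁ ∧ t ∈ l₂) ∨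
      [x, y, z, t].Sublist l₁ := by
  obtain ⟨s₁, s₂, hs, h₁, h₂⟩ := List.sublist_append_iff.1 h
  rcases s₁ with _ | ⟨x₁, _ | ⟨x₂, _ | ⟨x₃, _ | ⟨x₄, _ | ⟨x₅, s⟩⟩⟩⟩⟩
  · simp only [List.nil_append] at hs
    subst hs
    exact Or.inl h₂
  · simp at hs
    obtain ⟨rfl, rfl⟩ := hs
    exact Or.inr (Or.inl ⟨List.singleton_sublist.1 h₁, h₂⟩)
  · simp at hs
    obtain ⟨rfl, rfl, rfl⟩ := hs
    exact Or.inr (Or.inr (Or.inl ⟨h₁, h₂⟩))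
  · simp at hs
    obtain ⟨rfl, rfl, rfl, rfl⟩ := hs
    exact Or.inr (Or.inr (Or.inr (Or.inl ⟨h₁, List.singleton_sublist.1 h₂⟩)))
  · simp at hs
    obtain ⟨rfl, rfl, rfl, rfl, rfl⟩ := hs
    exact Or.inr (Or.inr (Or.inr (Or.inr h₁)))
  · simp at hs

/-- Moving the last entry of an alternation a, b, a, b to the front gives b, a, b, a, so crossing is
a cyclic notion. -/
theorem Noncrossing.rotate_one {x : α} (h : Noncrossing (x :: l)) : Noncrossing (l ++ [x]) := by
  intro a b hab hs
  rcases sublist_append_cases hs with h' | ⟨-, h'⟩ | ⟨-, h'⟩ | ⟨h', hb⟩ | h'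
  · simpa using h'.length_le
  · simpa using h'.length_le
  · simpa using h'.length_le
  · rw [List.mem_singleton] at hb
    subst hb
    exact h _ _ hab.symm (h'.cons_cons b)
  · exact h _ _ hab (h'.trans (List.sublist_cons_self _ _))

theorem Noncrossing.rotate (h : Noncrossing l) (n : ℕ) : Noncrossing (l.rotate n) := by
  induction n generalizing l with
  | zero => simpa using h
  | succ n ih =>
    cases l with
    | nil => simpa using h
    | cons x l =>
      rw [List.rotate_cons_succ]
      exact ih h.rotate_one

theorem Noncrossing.of_isRotated (h : Noncrossing l) (hr : l ~r l') : Noncrossing l' := by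
  obtain ⟨n, rfl⟩ := hr
  exact h.rotate n

theorem sublist_of_sublist_cons_of_ne {x y : α} {s t : List α} (hxy : x ≠ y)
    (h : (x :: s).Sublist (y :: t)) : (x :: s).Sublist t := by
  rcases List.sublist_cons_iff.1 h with h | ⟨r, hr, -⟩
  · exact h
  · exact absurd (List.cons.inj hr).1 hxy

/-- Joining two noncrossing lists at their common first entry. -/
theorem Noncrossing.append {u : α} {l₁ l₂ : List α} (h₁ : Noncrossing (u :: l₁))
    (h₂ : Noncrossing (u :: l₂)) (h : ∀ x ∈ u :: l₁, x ∈ u :: l₂ → x = u) :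
    Noncrossing ((u :: l₁) ++ (u :: l₂)) := by
  intro a b hab hs
  rcases sublist_append_cases hs with h' | ⟨ha, h'⟩ | ⟨h', h''⟩ | ⟨h', hb⟩ | h'
  · exact h₂ _ _ hab h'
  -- Here `a` lies in both lists, hence is `u`; the head of the second list replaces the `a` found
  -- in the first, so the whole alternation lies in the second list.
  · have hau := h a ha (h'.subset (by simp))
    subst hau
    exact h₂ _ _ hab ((sublist_of_sublist_cons_of_ne hab.symm h').cons_cons a)
  · exact hab ((h a (h'.subset (by simp)) (h''.subset (by simp))).trans
      (h b (h'.subset (by simp)) (h''.subset (by simp))).symm)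
  · have hbu := h b (h'.subset (by simp)) hb
    subst hbu
    exact h₁ _ _ hab.symm ((sublist_of_sublist_cons_of_ne hab h').cons_cons b)
  · exact h₁ _ _ hab h'

end Lists

/-! ### Noncrossing closed trails and the closure under gluing. -/

/-- The common vertices of a simple closed subwalk and of the rest of a noncrossing walk. -/
theorem eq_of_mem_of_noncrossing {p β q : List V} {u x : V}
    (h : Noncrossing (p ++ (u :: β) ++ u :: q)) (hx : x ∈ u :: β) (hx' : x ∈ p ++ u :: q) :
    x = u := by
  by_contra hxu
  have hxβ : x ∈ β := (List.mem_cons.1 hx).resolve_left hxu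
  have hβ : [u, x].Sublist (u :: β) := (List.singleton_sublist.2 hxβ).cons_cons u
  rcases List.mem_append.1 hx' with hp | hq
  · refine h x u hxu ?_
    have h1 : [x].Sublist p := List.singleton_sublist.2 hp
    have h2 : [u].Sublist (u :: q) := List.singleton_sublist.2 (by simp)
    exact (h1.append hβ).append h2
  · have hq' : x ∈ q := (List.mem_cons.1 hq).resolve_left hxu
    refine h u x (Ne.symm hxu) ?_
    have h2 : [u, x].Sublist (u :: q) := (List.singleton_sublist.2 hq').cons_cons u
    have := (List.nil_sublist p).append (hβ.append h2)
    simpa using this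

/-- A closed trail that repeats a vertex and is noncrossing splits into a cycle and a closed
trail with exactly one common vertex. -/
theorem IsWalk.exists_noncrossing_split {a : V} {w : List E} (h : D.IsWalk a w a)
    (hnd : w.Nodup) (hn : ¬ (w.map D.src).Nodup) (hc : Noncrossing (w.map D.src)) :
    ∃ p e β f q u, w = p ++ ((e :: β) ++ f :: q) ∧ D.IsWalk u (e :: β) u ∧
      D.IsWalk a (p ++ f :: q) a ∧ D.src e = u ∧ D.src f = u ∧
      ((e :: β).map D.src).Nodup ∧ (p ++ f :: q).Nodup ∧
      ∀ x ∈ (e :: β).map D.src, x ∈ (p ++ f :: q).map D.src → x = u := by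
  obtain ⟨p, β, f, q, u, rfl, h1, h2, h3, h4, h5⟩ := h.exists_split hn
  obtain ⟨e, β, rfl⟩ := List.exists_cons_of_ne_nil h1
  have hsub : (p ++ f :: q).Sublist (p ++ ((e :: β) ++ f :: q)) :=
    (List.Sublist.refl p).append (List.sublist_append_right _ _)
  refine ⟨p, e, β, f, q, u, rfl, h3, h2.append h4, h3.1, h4.1, h5, hnd.sublist hsub, ?_⟩
  intro x hx hx'
  have hu : D.src e = u := h3.1
  have hf : D.src f = u := h4.1
  simp only [List.map_append, List.map_cons, hu, hf] at hc hx hx'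
  exact eq_of_mem_of_noncrossing (p := p.map D.src) (q := q.map D.src) (β := β.map D.src)
    (by simpa using hc) hx hx'

theorem setOf_mem_split {α : Type*} {p b q : List α} :
    {x | x ∈ p ++ (b ++ q)} = {x | x ∈ b} ∪ {x | x ∈ p ++ q} := by
  ext x
  simp only [List.mem_append, Set.mem_ofPred_eq, Set.mem_union]
  tauto

/-- A trail that is not a cycle is a cycle glued at one vertex to a shorter noncrossing trail. -/
theorem inCycleClosure_of_noncrossing {w : List E} (h : D.IsClosedTrail w)
    (hc : Noncrossing (w.map D.src)) : D.InCycleClosure {e | e ∈ w} := by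
  induction hn : w.length using Nat.strong_induction_on generalizing w with
  | _ n ih =>
    by_cases hd : (w.map D.src).Nodup
    · exact InCycleClosure.cycle (w : Cycle E) ⟨w, h, hd, rfl⟩
    · obtain ⟨hw, hnd, a, ha⟩ := isClosedTrail_iff.1 h
      obtain ⟨p, e, β, f, q, u, rfl, h1, h2, h3, h4, h5, h6, h7⟩ :=
        ha.exists_noncrossing_split hnd hd hc
      have hβ : D.IsClosedTrail (e :: β) := isClosedTrail_iff.2 ⟨by simp, h5.of_map, u, h1⟩
      have hr : D.IsClosedTrail (p ++ f :: q) := isClosedTrail_iff.2 ⟨by simp, h6, a, h2⟩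
      rw [setOf_mem_split]
      refine InCycleClosure.ast _ _ u (InCycleClosure.cycle _ ⟨e :: β, hβ, h5, rfl⟩)
        (ih _ (by simp at hn ⊢; omega) hr (hc.sublist ?_) rfl) ?_
      · exact ((List.Sublist.refl p).append (List.sublist_append_right _ _)).map _
      · show D.vertsOf {x | x ∈ e :: β} ∩ _ = _
        rw [hβ.vertsOf_eq, hr.vertsOf_eq]
        ext x
        constructor
        · rintro ⟨hx, hx'⟩
          exact h7 x hx hx'
        · rintro rfl
          exact ⟨by simp [h3], by simp [h4]⟩

/-- Trails of the two parts are rotated to start at the common vertex and then concatenated. -/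
theorem InCycleClosure.exists_noncrossing {F : Set E} (h : D.InCycleClosure F) :
    ∃ w, D.IsClosedTrail w ∧ {e | e ∈ w} = F ∧ Noncrossing (w.map D.src) := by
  induction h with
  | cycle z hz =>
    obtain ⟨w, hw, hn, rfl⟩ := hz
    exact ⟨w, hw, rfl, noncrossing_of_nodup hn⟩
  | ast F₁ F₂ u _ _ hu ih₁ ih₂ =>
    obtain ⟨w₁, hw₁, rfl, hc₁⟩ := ih₁
    obtain ⟨w₂, hw₂, rfl, hc₂⟩ := ih₂
    have hu' : u ∈ ({u} : Set V) := rfl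
    rw [← hu, hw₁.vertsOf_eq, hw₂.vertsOf_eq] at hu'
    obtain ⟨e₁, he₁, hu₁⟩ := List.mem_map.1 hu'.1
    obtain ⟨e₂, he₂, hu₂⟩ := List.mem_map.1 hu'.2
    obtain ⟨l₁, hr₁, hl₁⟩ := hw₁.exists_rotation he₁
    obtain ⟨l₂, hr₂, hl₂⟩ := hw₂.exists_rotation he₂
    rw [hu₁] at hl₁
    rw [hu₂] at hl₂
    have hcommon : ∀ x ∈ w₁.map D.src, x ∈ w₂.map D.src → x = u := by
      intro x hx hx'
      have : x ∈ D.vertsOf {e | e ∈ w₁} ∩ D.vertsOf {e | e ∈ w₂} := by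
        rw [hw₁.vertsOf_eq, hw₂.vertsOf_eq]
        exact ⟨hx, hx'⟩
      rw [hu] at this
      exact this
    have hc₁' := hc₁.of_isRotated (hr₁.map D.src)
    have hc₂' := hc₂.of_isRotated (hr₂.map D.src)
    classical
    -- The operation `∗` does not forbid common edges, but such an edge has both ends at `u`, so it
    -- is a loop and can be deleted from the second trail without breaking the walk.
    set l := (e₂ :: l₂).filter (fun e => decide (e ∉ w₁)) with hl
    have hwalk : D.IsWalk u l u := by
      refine hl₂.filter _ fun e he he' => ?_
      have hew₁ : e ∈ w₁ := by simpa using he'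
      have hew₂ : e ∈ w₂ := hr₂.mem_iff.2 he
      rw [hcommon _ (List.mem_map_of_mem hew₁) (List.mem_map_of_mem hew₂),
        hcommon _ (hw₁.tgt_mem hew₁) (hw₂.tgt_mem hew₂)]
    have hsub : l.Sublist (e₂ :: l₂) := List.filter_sublist
    refine ⟨(e₁ :: l₁) ++ l, isClosedTrail_iff.2 ⟨by simp, ?_, u, hl₁.append hwalk⟩, ?_, ?_⟩
    · refine List.nodup_append.2 ⟨hr₁.nodup_iff.1 hw₁.2.1,
        (hr₂.nodup_iff.1 hw₂.2.1).sublist hsub, ?_⟩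
      rintro x hx y hy rfl
      have := (List.mem_filter.1 hy).2
      simp only [decide_eq_true_eq] at this
      exact this (hr₁.mem_iff.2 hx)
    · ext x
      simp only [Set.mem_ofPred_eq, List.mem_append, Set.mem_union, hl, List.mem_filter,
        decide_eq_true_eq, ← hr₁.mem_iff, ← hr₂.mem_iff]
      tauto
    · cases hl' : l with
      | nil => simpa using hc₁'
      | cons e l' =>
        rw [hl'] at hwalk hsub
        have he : D.src e = u := hwalk.1
        have hc₃ := hc₂'.sublist (hsub.map D.src)
        rw [List.map_append]
        simp only [List.map_cons, hu₁, he] at hc₁' hc₃ ⊢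
        refine hc₁'.append hc₃ fun x hx hx' => hcommon x ?_ ?_
        · refine (hr₁.map D.src).mem_iff.2 ?_
          simpa [hu₁] using hx
        · refine (hr₂.map D.src).mem_iff.2 ((hsub.map D.src).subset ?_)
          simpa [he] using hx'

/-- A closed trail without crossings that visits every vertex at most twice. -/
def IsTreelike (D : MultiDigraph V E) (w : List E) : Prop :=
  D.IsClosedTrail w ∧ AtMostTwice (w.map D.src) ∧ Noncrossing (w.map D.src)

theorem atMostTwice_of_outDegree [Finite V] [Finite E] (h : D.maxOutDegree ≤ 2) {w : List E}
    (hw : w.Nodup) : AtMostTwice (w.map D.src) := by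
  intro a ha
  obtain ⟨s, hs, hs'⟩ := List.sublist_map_iff.1 ha
  have hd : D.outDegree a ≤ 2 :=
    (le_ciSup (Set.finite_range D.outDegree).bddAbove a).trans h
  rcases s with _ | ⟨x, _ | ⟨y, _ | ⟨z, s⟩⟩⟩
  · simp at hs'
  · simp at hs'
  · simp at hs'
  · simp at hs'
    obtain ⟨hx, hy, hz, rfl⟩ := hs'
    have hn := hw.sublist hs
    simp at hn
    have h3 : 2 < {e : E | D.src e = a}.ncard := by
      rw [Set.two_lt_ncard_iff (Set.toFinite _)]
      exact ⟨x, y, z, hx.symm, hy.symm, hz.symm, hn.1.1, hn.1.2, hn.2⟩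
    unfold outDegree at hd
    omega

theorem maxOutDegree_le_of_atMostTwice [Nonempty V] {w : List E} (hw : ∀ e, e ∈ w)
    (h : AtMostTwice (w.map D.src)) : D.maxOutDegree ≤ 2 := by
  classical
  refine ciSup_le fun v => ?_
  have hsub : {e : E | D.src e = v} ⊆ ((w.filter (fun e => decide (D.src e = v))).toFinset : Set E) := by
    intro e he
    simp only [List.coe_toFinset, List.mem_filter, Set.mem_ofPred_eq, decide_eq_true_eq]
    exact ⟨hw e, he⟩
  refine (Set.ncard_le_ncard hsub (Finset.finite_toSet _)).trans ?_
  rw [Set.ncard_coe_finset]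
  refine (List.toFinset_card_le _).trans ?_
  have := atMostTwice_iff_count.1 h v
  rw [List.count, List.countP_map, List.countP_eq_length_filter] at this
  have he : (fun x => x == v) ∘ D.src = fun e => decide (D.src e = v) := by
    ext e
    by_cases h' : D.src e = v <;> simp [h']
  rwa [he] at this

end MultiDigraph

/-! ### Uniqueness of the circuit of a treelike trail. -/

namespace MultiDigraph

variable {V E : Type*} {D : MultiDigraph V E}

/-- Two walks from one vertex cannot diverge where the next edge is forced by its source. -/
theorem IsWalk.prefix_or_prefix {a b c : V} {l₁ l₂ : List E} (h₁ : D.IsWalk a l₁ b)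
    (h₂ : D.IsWalk a l₂ c) (h : ∀ f ∈ l₁, ∀ g ∈ l₂, D.src g = D.src f → g = f) :
    l₁ <+: l₂ ∨ l₂ <+: l₁ := by
  induction l₁ generalizing a l₂ with
  | nil => exact Or.inl List.nil_prefix
  | cons e l ih =>
    cases l₂ with
    | nil => exact Or.inr List.nil_prefix
    | cons f m =>
      have hfe : f = e := h e (by simp) f (by simp) (h₂.1.trans h₁.1.symm)
      subst hfe
      rcases ih h₁.2 h₂.2 (fun f hf g hg => h f (by simp [hf]) g (by simp [hg])) with h' | h'
      · exact Or.inl (by simpa using h')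
      · exact Or.inr (by simpa using h')

/-- The two permitted visits to `u` are used up by `e` and `f`, so after removal of the closed
subwalk only `f` leaves `u`. -/
theorem AtMostTwice.eq_of_src_eq {p β q : List E} {e f g : E} {u : V}
    (h : AtMostTwice ((p ++ ((e :: β) ++ f :: q)).map D.src)) (he : D.src e = u)
    (hf : D.src f = u) (hg : g ∈ p ++ f :: q) (hgu : D.src g = u) : g = f := by
  by_contra hgf
  simp only [List.mem_append, List.mem_cons, hgf, false_or] at hg
  refine h u ?_
  simp only [List.map_append, List.map_cons, he, hf]
  have s2 : [u].Sublist (u :: β.map D.src) := List.singleton_sublist.2 (by simp)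
  rcases hg with hg | hg
  · have s1 : [u].Sublist (p.map D.src) :=
      List.singleton_sublist.2 (hgu ▸ List.mem_map_of_mem hg)
    have s3 : [u].Sublist (u :: q.map D.src) := List.singleton_sublist.2 (by simp)
    exact s1.append (s2.append s3)
  · have s3 : [u, u].Sublist (u :: q.map D.src) :=
      (List.singleton_sublist.2 (hgu ▸ List.mem_map_of_mem hg)).cons_cons u
    exact (List.nil_sublist _).append (s2.append s3)

/-- A treelike closed trail is, up to rotation, the only closed trail with its edges. -/
theorem IsTreelike.isRotated_of_perm {w w' : List E} (h : D.IsTreelike w)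
    (h' : D.IsClosedTrail w') (hp : w'.Perm w) : w' ~r w := by
  induction hn : w.length using Nat.strong_induction_on generalizing w w' with
  | _ n ih =>
    obtain ⟨hw, ht, hc⟩ := h
    obtain ⟨hw0, hnd, a, ha⟩ := isClosedTrail_iff.1 hw
    by_cases hd : (w.map D.src).Nodup
    · obtain ⟨e, l, rfl⟩ := List.exists_cons_of_ne_nil hw0
      obtain ⟨t, hr, ht⟩ := h'.exists_rotation (hp.mem_iff.2 (List.mem_cons_self (a := e)))
      have hlen : t.length = l.length := by
        have := hr.perm.length_eq.symm.trans hp.length_eq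
        simpa using this
      have hpre : l <+: t ∨ t <+: l := by
        refine IsWalk.prefix_or_prefix ha.2 ht.2 fun f hf g hg hfg => ?_
        refine List.inj_on_of_nodup_map hd ?_ (by simp [hf]) hfg
        exact hp.mem_iff.1 (hr.mem_iff.2 (by simp [hg]))
      have : t = l := by
        rcases hpre with h | h
        · exact (h.eq_of_length hlen.symm).symm
        · exact h.eq_of_length hlen
      rwa [this] at hr
    · obtain ⟨p, e, β, f, q, u, rfl, h1, h2, h3, h4, h5, h6, h7⟩ :=
        ha.exists_noncrossing_split hnd hd hc
      have hew : e ∈ p ++ (e :: β ++ f :: q) := by simp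
      obtain ⟨t, hr, hwt⟩ := h'.exists_rotation (hp.mem_iff.2 hew)
      have hpt : (e :: t).Perm (p ++ (e :: β ++ f :: q)) := hr.perm.symm.trans hp
      have hpw : (p ++ (e :: β ++ f :: q)).Perm (e :: β ++ (p ++ f :: q)) := by
        rw [← List.append_assoc, ← List.append_assoc]
        exact List.perm_append_comm.append_right _
      have hsub : (p ++ f :: q).Sublist (p ++ ((e :: β) ++ f :: q)) :=
        (List.Sublist.refl p).append (List.sublist_append_right _ _)
      have hlen : t.length = β.length + (p ++ f :: q).length := by
        have := (hpt.trans hpw).length_eq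
        simpa using this
      have hsrc : ∀ g ∈ β, D.src g ≠ u := by
        intro g hg hgu
        rw [List.map_cons, List.nodup_cons, h3, ← hgu] at h5
        exact h5.1 (List.mem_map_of_mem hg)
      -- The interior vertices of the split-off cycle lie on no other part of the trail, so any
      -- trail entering the cycle by `e` must follow it to the end.
      have hpre : β <+: t := by
        have hor : β <+: t ∨ t <+: β := by
          refine IsWalk.prefix_or_prefix h1.2 hwt.2 fun g hg k hk hkg => ?_
          have hk' : k ∈ e :: β ++ (p ++ f :: q) := (hpt.trans hpw).mem_iff.1 (by simp [hk])
          rcases List.mem_append.1 hk' with hk' | hk'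
          · exact List.inj_on_of_nodup_map h5 hk' (by simp [hg]) hkg
          · refine absurd (h7 (D.src g) ?_ ?_) (hsrc g hg)
            · exact List.mem_map_of_mem (by simp [hg])
            · rw [← hkg]
              exact List.mem_map_of_mem hk'
        rcases hor with h | h
        · exact h
        · have := h.length_le
          simp at hlen
          omega
      obtain ⟨t', rfl⟩ := hpre
      have hpt' : t'.Perm (p ++ f :: q) := by
        have := hpt.trans hpw
        rw [← List.cons_append] at this
        exact (List.perm_append_left_iff _).1 this
      have hwt' : D.IsWalk u t' u := by
        rw [← List.cons_append, h3] at hwt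
        obtain ⟨b, hb, hb'⟩ := isWalk_append_iff.1 hwt
        rwa [← h1.end_unique hb] at hb'
      have ht'0 : t' ≠ [] := by
        rintro rfl
        simpa using hpt'.length_eq
      have hct' : D.IsClosedTrail t' :=
        isClosedTrail_iff.2 ⟨ht'0, hpt'.nodup_iff.2 h6, u, hwt'⟩
      have hrest : D.IsTreelike (p ++ f :: q) :=
        ⟨isClosedTrail_iff.2 ⟨by simp, h6, a, h2⟩, ht.sublist (hsub.map _),
          hc.sublist (hsub.map _)⟩
      have hrt' := ih (p ++ f :: q).length (by simp at hn ⊢; omega) hrest hct' hpt' rfl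
      obtain ⟨g, t'', rfl⟩ := List.exists_cons_of_ne_nil ht'0
      -- Back at `u` the only remaining exit is `f`. The induction hypothesis fixes the rest up to
      -- rotation, and the known first edge then fixes it as a list.
      have hgf : g = f := ht.eq_of_src_eq h3 h4 (hpt'.mem_iff.1 (by simp)) hwt'.1
      subst hgf
      have hrot : (p ++ g :: q) ~r (g :: (q ++ p)) := List.isRotated_append
      have heq : t'' = q ++ p :=
        eq_of_isRotated_of_head (hpt'.nodup_iff.2 h6) (hrt'.trans hrot)
      refine hr.trans ?_
      rw [heq]
      have : e :: (β ++ g :: (q ++ p)) = (e :: β ++ g :: q) ++ p := by simp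
      rw [this]
      exact List.isRotated_append

theorem IsTreelike.existsUnique_eulerianCircuit {w : List E} (h : D.IsTreelike w)
    (hw : ∀ e, e ∈ w) : ∃! z : Cycle E, z ∈ D.eulerianCircuits := by
  refine ⟨w, ⟨w, ⟨h.1, hw⟩, rfl⟩, ?_⟩
  rintro _ ⟨w', ⟨hw', hall⟩, rfl⟩
  refine Cycle.coe_eq_coe.2 (h.isRotated_of_perm hw' ?_)
  exact (List.perm_ext_iff_of_nodup hw'.2.1 h.1.2.1).2 fun e => by simp [hw, hall]

theorem IsClosedTrail.isTreelike_of_nodup {w : List E} (h : D.IsClosedTrail w)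
    (hn : (w.map D.src).Nodup) : D.IsTreelike w :=
  ⟨h, atMostTwice_of_nodup hn, noncrossing_of_nodup hn⟩

/-! ### Cycles, biconnected sets and blocks of a cactus. -/

/-- A cycle whose edges all lie on another cycle is equal to it. -/
theorem eq_of_cycles_subset {z z' : Cycle E} (hz : z ∈ D.cycles) (hz' : z' ∈ D.cycles)
    (h : ∀ e ∈ z, e ∈ z') : z = z' := by
  obtain ⟨w, hw, hn, rfl⟩ := hz
  obtain ⟨w', hw', hn', rfl⟩ := hz'
  simp only [Cycle.mem_coe_iff] at h
  obtain ⟨e, he⟩ := List.exists_mem_of_ne_nil w hw.1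
  have hback : ∀ f ∈ w', f ∈ w := by
    refine hw'.forall_of_succ (h e he) he fun f _ g hg hfg hfw => ?_
    obtain ⟨k, hk, hk'⟩ := List.mem_map.1 (hw.tgt_mem hfw)
    have : k = g := List.inj_on_of_nodup_map hn' (h k hk) hg (hk'.trans hfg)
    exact this ▸ hk
  refine Cycle.coe_eq_coe.2 ((hw'.isTreelike_of_nodup hn').isRotated_of_perm hw ?_)
  exact (List.perm_ext_iff_of_nodup hw.2.1 hw'.2.1).2 fun e => ⟨h e, hback e⟩

/-- If the edges are split in two, the cycle passes from the first part to the second and back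
again. If both passages took place at one vertex, the edges leaving there would coincide, yet they
lie in different parts. -/
theorem isBiconnected_of_mem_cycles {z : Cycle E} (hz : z ∈ D.cycles) :
    D.IsBiconnected {e | e ∈ z} := by
  obtain ⟨w, hw, hn, rfl⟩ := hz
  simp only [Cycle.mem_coe_iff]
  obtain ⟨e, he⟩ := List.exists_mem_of_ne_nil w hw.1
  refine ⟨⟨e, he⟩, fun v A B hA hB hAB hU hv => ?_⟩
  have key : ∀ A B : Set E, A.Nonempty → B.Nonempty → Disjoint A B → A ∪ B = {e | e ∈ w} →
      ∃ f ∈ A, ∃ g ∈ B, D.tgt f = D.src g := by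
    rintro A B ⟨a, ha⟩ ⟨b, hb⟩ hAB hU
    by_contra! hcon
    have haw : a ∈ w := (Set.ext_iff.1 hU a).1 (Or.inl ha)
    have hbw : b ∈ w := (Set.ext_iff.1 hU b).1 (Or.inr hb)
    refine Set.disjoint_left.1 hAB (hw.forall_of_succ (P := (· ∈ A)) haw ha ?_ b hbw) hb
    intro f _ g hg hfg hf
    rcases (Set.ext_iff.1 hU g).2 hg with h' | h'
    · exact h'
    · exact absurd hfg (hcon f hf g h')
  obtain ⟨f, hf, g, hg, hfg⟩ := key A B hA hB hAB hU
  obtain ⟨f', hf', g', hg', hfg'⟩ := key B A hB hA hAB.symm (by rw [Set.union_comm, hU])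
  have h1 : D.src g = v := hv ⟨hfg ▸ tgt_mem_vertsOf hf, src_mem_vertsOf hg⟩
  have h2 : D.src g' = v := hv ⟨src_mem_vertsOf hg', hfg' ▸ tgt_mem_vertsOf hf'⟩
  have : g = g' := List.inj_on_of_nodup_map hn ((Set.ext_iff.1 hU g).1 (Or.inr hg))
    ((Set.ext_iff.1 hU g').1 (Or.inl hg')) (h1.trans h2.symm)
  exact Set.disjoint_left.1 hAB hg' (this ▸ hg)

theorem IsBiconnected.subset_or_subset {F F₁ F₂ : Set E} {u : V} (h : D.IsBiconnected F)
    (hF : F ⊆ F₁ ∪ F₂) (hu : D.vertsOf F₁ ∩ D.vertsOf F₂ ⊆ {u}) : F ⊆ F₁ ∨ F ⊆ F₂ := by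
  by_contra! hcon
  obtain ⟨x, hx, hx₁⟩ := Set.not_subset.1 hcon.1
  obtain ⟨y, hy, hy₂⟩ := Set.not_subset.1 hcon.2
  have hy₁ : y ∈ F₁ := (hF hy).resolve_right hy₂
  refine h.2 u (F ∩ F₁) (F \ F₁) ⟨y, hy, hy₁⟩ ⟨x, hx, hx₁⟩
    (Set.disjoint_left.2 fun z hz hz' => hz'.2 hz.2) (Set.inter_union_sdiff F F₁) ?_
  refine Set.Subset.trans (Set.inter_subset_inter (vertsOf_mono Set.inter_subset_right)
    (vertsOf_mono ?_)) hu
  exact fun z hz => (hF hz.1).resolve_left hz.2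

/-- A split at one vertex separates neither set, and the common edge puts both on the same side. -/
theorem IsBiconnected.union {F G : Set E} (hF : D.IsBiconnected F) (hG : D.IsBiconnected G)
    {e : E} (heF : e ∈ F) (heG : e ∈ G) : D.IsBiconnected (F ∪ G) := by
  refine ⟨⟨e, Or.inl heF⟩, fun v A B hA hB hAB hU hv => ?_⟩
  have hF' := hF.subset_or_subset (hU ▸ Set.subset_union_left) hv
  have hG' := hG.subset_or_subset (hU ▸ Set.subset_union_right) hv
  rcases hF' with hF' | hF' <;> rcases hG' with hG' | hG'
  · obtain ⟨b, hb⟩ := hB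
    have : b ∈ F ∪ G := hU ▸ Or.inr hb
    exact Set.disjoint_left.1 hAB (this.elim (fun h => hF' h) fun h => hG' h) hb
  · exact Set.disjoint_left.1 hAB (hF' heF) (hG' heG)
  · exact Set.disjoint_left.1 hAB (hG' heG) (hF' heF)
  · obtain ⟨b, hb⟩ := hA
    have : b ∈ F ∪ G := hU ▸ Or.inl hb
    exact Set.disjoint_left.1 hAB hb (this.elim (fun h => hF' h) fun h => hG' h)

theorem InCycleClosure.exists_cycle_of_isBiconnected {F G : Set E} (h : D.InCycleClosure F)
    (hG : D.IsBiconnected G) (hGF : G ⊆ F) : ∃ z ∈ D.cycles, G ⊆ {e | e ∈ z} := by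
  induction h with
  | cycle z hz => exact ⟨z, hz, hGF⟩
  | ast F₁ F₂ u _ _ hu ih₁ ih₂ =>
    rcases hG.subset_or_subset hGF hu.subset with h | h
    · exact ih₁ h
    · exact ih₂ h

theorem InCycleClosure.exists_cycle_of_mem {F : Set E} (h : D.InCycleClosure F) {e : E}
    (he : e ∈ F) : ∃ z ∈ D.cycles, e ∈ z := by
  induction h with
  | cycle z hz => exact ⟨z, hz, he⟩
  | ast F₁ F₂ u _ _ hu ih₁ ih₂ => exact he.elim ih₁ ih₂

/-- In a cactus, cycles with a common edge are equal. -/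
theorem InCycleClosure.eq_of_mem_of_mem {F : Set E} (h : D.InCycleClosure F) {z z' : Cycle E}
    (hz : z ∈ D.cycles) (hz' : z' ∈ D.cycles) (hzF : ∀ e ∈ z, e ∈ F) (hzF' : ∀ e ∈ z', e ∈ F)
    {e : E} (he : e ∈ z) (he' : e ∈ z') : z = z' := by
  -- The union of the two cycles is biconnected, hence contained in a single cycle, which must equal
  -- both.
  have hb := (isBiconnected_of_mem_cycles hz).union (isBiconnected_of_mem_cycles hz') he he'
  obtain ⟨c, hc, hcs⟩ := h.exists_cycle_of_isBiconnected hb (Set.union_subset hzF hzF')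
  rw [eq_of_cycles_subset hz hc fun e he => hcs (Or.inl he),
    eq_of_cycles_subset hz' hc fun e he => hcs (Or.inr he)]

theorem IsBlock.eq_of_mem_of_mem {F G : Set E} (hF : D.IsBlock F) (hG : D.IsBlock G) {e : E}
    (heF : e ∈ F) (heG : e ∈ G) : F = G := by
  have hb := hF.prop.union hG.prop heF heG
  rw [hF.eq_of_subset hb Set.subset_union_left]
  exact (hG.eq_of_subset hb Set.subset_union_right).symm

theorem IsBridgelessCactus.exists_cycle_of_isBlock (h : D.IsBridgelessCactus) {F : Set E}
    (hF : D.IsBlock F) : ∃ z ∈ D.cycles, F = {e | e ∈ z} := by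
  obtain ⟨z, hz, hFz⟩ := h.1.exists_cycle_of_isBiconnected hF.prop (Set.subset_univ _)
  exact ⟨z, hz, hF.eq_of_subset (isBiconnected_of_mem_cycles hz) hFz⟩

theorem exists_src_of_mem_circuitVerts {z : Cycle E} (hz : z ∈ D.cycles) {v : V}
    (hv : v ∈ D.circuitVerts z) : ∃ e ∈ z, D.src e = v := by
  obtain ⟨w, hw, hn, rfl⟩ := hz
  have : v ∈ D.vertsOf {e | e ∈ w} := hv
  rw [hw.vertsOf_eq] at this
  obtain ⟨e, he, h⟩ := List.mem_map.1 this
  exact ⟨e, he, h⟩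

theorem exists_tgt_of_mem_circuitVerts {z : Cycle E} (hz : z ∈ D.cycles) {v : V}
    (hv : v ∈ D.circuitVerts z) : ∃ e ∈ z, D.tgt e = v := by
  obtain ⟨e, he, rfl⟩ := exists_src_of_mem_circuitVerts hz hv
  obtain ⟨w, hw, hn, rfl⟩ := hz
  obtain ⟨l, hr, hl⟩ := hw.exists_rotation he
  obtain ⟨f, hf, hf'⟩ := hl.exists_tgt_eq_end (by simp)
  exact ⟨f, hr.mem_iff.2 hf, hf'⟩

theorem src_injOn_of_mem_cycles {z : Cycle E} (hz : z ∈ D.cycles) :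
    Set.InjOn D.src {e | e ∈ z} := by
  obtain ⟨w, hw, hn, rfl⟩ := hz
  exact fun e he f hf hef => List.inj_on_of_nodup_map hn he hf hef

/-- In a cactus, the blocks at a vertex correspond to the edges leaving it. -/
theorem IsBridgelessCactus.encard_blocks [Finite E] (h : D.IsBridgelessCactus) (v : V) :
    {F : Set E | D.IsBlock F ∧ v ∈ D.vertsOf F}.encard = D.outDegree v := by
  have hex : ∀ e : E, ∃ F, D.IsBlock F ∧ e ∈ F := by
    intro e
    obtain ⟨z, hz, he⟩ := h.1.exists_cycle_of_mem (Set.mem_univ e)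
    obtain ⟨F, hzF, hF⟩ := (Set.toFinite {F : Set E | D.IsBiconnected F}).exists_le_maximal
      (isBiconnected_of_mem_cycles hz)
    exact ⟨F, hF, hzF he⟩
  choose f hf hef using hex
  unfold outDegree
  rw [Set.Finite.cast_ncard_eq (Set.toFinite _)]
  -- Here `f e` is the block containing `e`. Blocks are cycles, so each block at `v` contains
  -- exactly one edge leaving `v`.
  have himg : {F : Set E | D.IsBlock F ∧ v ∈ D.vertsOf F} = f '' {e | D.src e = v} := by
    ext F
    constructor
    · rintro ⟨hF, hv⟩
      obtain ⟨z, hz, rfl⟩ := h.exists_cycle_of_isBlock hF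
      obtain ⟨e, he, hev⟩ := exists_src_of_mem_circuitVerts hz hv
      exact ⟨e, hev, (hf e).eq_of_mem_of_mem hF (hef e) he⟩
    · rintro ⟨e, rfl, rfl⟩
      exact ⟨hf e, src_mem_vertsOf (hef e)⟩
  rw [himg, Set.InjOn.encard_image]
  intro e he e' he' hee
  obtain ⟨z, hz, hz'⟩ := h.exists_cycle_of_isBlock (hf e)
  refine src_injOn_of_mem_cycles hz (hz' ▸ hef e) (hz' ▸ ?_) (Eq.trans he (Eq.symm he'))
  rw [hee]
  exact hef e'

theorem christmasCactus_iff [Finite V] [Finite E] [Nonempty V] :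
    D.IsBridgelessCactus ∧ D.maxOutDegree ≤ 2 ↔ D.IsBridgelessChristmasCactus := by
  refine and_congr_right fun h => ?_
  have hle : D.maxOutDegree ≤ 2 ↔ ∀ v, D.outDegree v ≤ 2 :=
    ⟨fun h' v => (le_ciSup (Set.finite_range D.outDegree).bddAbove v).trans h', ciSup_le⟩
  rw [hle]
  refine forall_congr' fun v => ?_
  rw [h.encard_blocks v]
  norm_cast

end MultiDigraph

/-! ### Treelike trails give a tree of cycles. -/

/-- A new leaf creates no cycle: on a cycle through `b` the second and the penultimate vertex would
both be `c`, and a cycle avoiding `b` already lies in the old tree. -/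
theorem SimpleGraph.IsTree.induce_insert {α : Type*} {G : SimpleGraph α} {S : Set α} {b c : α}
    (h : (G.induce S).IsTree) (hb : b ∉ S) (hc : c ∈ S) (hbc : G.Adj b c)
    (hu : ∀ x ∈ S, G.Adj b x → x = c) : (G.induce (insert b S)).IsTree := by
  constructor
  · rw [connected_iff_exists_forall_reachable]
    refine ⟨⟨c, Or.inr hc⟩, ?_⟩
    rintro ⟨x, rfl | hx⟩
    · exact SimpleGraph.Adj.reachable (by simpa using hbc.symm)
    · have := h.1.preconnected ⟨c, hc⟩ ⟨x, hx⟩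
      exact this.map (SimpleGraph.induceHomOfLE G (Set.subset_insert b S)).toHom
  · have hub : ∀ x : ↥(insert b S), (G.induce (insert b S)).Adj ⟨b, Or.inl rfl⟩ x → x.1 = c := by
      rintro ⟨x, hx⟩ hadj
      have hadj' : G.Adj b x := hadj
      rcases hx with rfl | hx
      · exact absurd hadj' (G.loopless.irrefl _)
      · exact hu x hx hadj'
    intro v p hp
    by_cases hbp : (⟨b, Or.inl rfl⟩ : ↥(insert b S)) ∈ p.support
    · classical
      have hr := hp.rotate hbp
      refine hr.snd_ne_penultimate (Subtype.ext ?_)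
      rw [hub _ (SimpleGraph.Walk.adj_snd hr.not_nil),
        hub _ (SimpleGraph.Walk.adj_penultimate hr.not_nil).symm]
    · have hT : ∀ x ∈ p.support, x ∈ {x : ↥(insert b S) | x.1 ∈ S} := by
        intro x hx
        rcases x with ⟨x, rfl | hx'⟩
        · exact absurd hx hbp
        · exact hx'
      have hac : ((G.induce (insert b S)).induce {x | x.1 ∈ S}).IsAcyclic := by
        refine h.2.comap (G := (G.induce (insert b S)).induce {x | x.1 ∈ S})
          ⟨fun x => ⟨x.1.1, x.2⟩, fun h => h⟩ ?_
        intro x y hxy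
        have hxy' : x.1.1 = y.1.1 := congrArg (fun z : S => z.1) hxy
        exact Subtype.ext (Subtype.ext hxy')
      refine hac (p.induce _ hT) ?_
      have hinj : Function.Injective (SimpleGraph.Embedding.induce (G := G.induce (insert b S))
          {x | x.1 ∈ S}).toHom := fun _ _ h => Subtype.ext h
      refine (SimpleGraph.Walk.isCycle_map_iff_of_injective hinj).1 ?_
      rw [SimpleGraph.Walk.map_induce]
      exact hp

namespace MultiDigraph

variable {V E : Type*} {D : MultiDigraph V E}

/-- The intersection graph on all circuits. -/
def circuitIntersectionGraph (D : MultiDigraph V E) : SimpleGraph (Cycle E) where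
  Adj β γ := β ≠ γ ∧ (D.circuitVerts β ∩ D.circuitVerts γ).Nonempty
  symm := ⟨fun _ _ h => ⟨h.1.symm, by rw [Set.inter_comm]; exact h.2⟩⟩
  loopless := ⟨fun _ h => h.1 rfl⟩

/-- The cycles whose edges belong to the list `w`. -/
def cyclesIn (D : MultiDigraph V E) (w : List E) : Set (Cycle E) :=
  {z | z ∈ D.cycles ∧ ∀ e ∈ z, e ∈ w}

theorem mem_circuitVerts {w : List E} (h : D.IsClosedTrail w) {v : V} :
    v ∈ D.circuitVerts (w : Cycle E) ↔ v ∈ w.map D.src := by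
  have : D.circuitVerts (w : Cycle E) = D.vertsOf {e | e ∈ w} := rfl
  rw [this, h.vertsOf_eq]
  rfl

/-- The split-off cycle is a leaf. A neighbour of it must pass through `u`, hence use `f`, the only
remaining edge leaving `u`; cycles of a cactus sharing an edge are equal, so there is just one
neighbour. Working inside the graph on all circuits lets the vertex set grow with the induction. -/
theorem IsTreelike.isTree {w : List E} (h : D.IsTreelike w) :
    (D.circuitIntersectionGraph.induce (D.cyclesIn w)).IsTree := by
  induction hn : w.length using Nat.strong_induction_on generalizing w with
  | _ n ih =>
    obtain ⟨hw, ht, hc⟩ := h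
    obtain ⟨hw0, hnd, a, ha⟩ := isClosedTrail_iff.1 hw
    by_cases hd : (w.map D.src).Nodup
    · have hwc : (w : Cycle E) ∈ D.cycles := ⟨w, hw, hd, rfl⟩
      have hsing : D.cyclesIn w = {(w : Cycle E)} := by
        ext z
        constructor
        · rintro ⟨hz, hzw⟩
          exact eq_of_cycles_subset hz hwc hzw
        · rintro rfl
          exact ⟨hwc, fun e he => he⟩
      rw [hsing]
      exact SimpleGraph.IsTree.of_subsingleton
    · obtain ⟨p, e, β, f, q, u, rfl, h1, h2, h3, h4, h5, h6, h7⟩ :=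
        ha.exists_noncrossing_split hnd hd hc
      have hβ : D.IsClosedTrail (e :: β) := isClosedTrail_iff.2 ⟨by simp, h5.of_map, u, h1⟩
      have hβc : ((e :: β : List E) : Cycle E) ∈ D.cycles := ⟨_, hβ, h5, rfl⟩
      have hr : D.IsClosedTrail (p ++ f :: q) := isClosedTrail_iff.2 ⟨by simp, h6, a, h2⟩
      have hsub : (p ++ f :: q).Sublist (p ++ ((e :: β) ++ f :: q)) :=
        (List.Sublist.refl p).append (List.sublist_append_right _ _)
      have hrt : D.IsTreelike (p ++ f :: q) :=
        ⟨hr, ht.sublist (hsub.map _), hc.sublist (hsub.map _)⟩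
      have hverts : ∀ v, v ∈ D.circuitVerts ((e :: β : List E) : Cycle E) →
          v ∈ (p ++ f :: q).map D.src → v = u :=
        fun v hv hv' => h7 v ((mem_circuitVerts hβ).1 hv) hv'
      have hin : ∀ z ∈ D.cyclesIn (p ++ f :: q), ∀ v ∈ D.circuitVerts z,
          v ∈ (p ++ f :: q).map D.src := by
        rintro z ⟨hz, hzr⟩ v hv
        obtain ⟨g, hg, rfl⟩ := exists_src_of_mem_circuitVerts hz hv
        exact List.mem_map_of_mem (hzr g hg)
      have hnot : ((e :: β : List E) : Cycle E) ∉ D.cyclesIn (p ++ f :: q) := by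
        rintro ⟨-, h⟩
        have h' := h e (by simp)
        rw [List.nodup_append] at hnd
        rcases List.mem_append.1 h' with h' | h'
        · exact hnd.2.2 e h' e (by simp) rfl
        · exact (List.nodup_append.1 hnd.2.1).2.2 e (by simp) e h' rfl
      have hins : D.cyclesIn (p ++ ((e :: β) ++ f :: q)) =
          insert ((e :: β : List E) : Cycle E) (D.cyclesIn (p ++ f :: q)) := by
        ext z
        constructor
        · rintro ⟨hz, hzw⟩
          have hor := (isBiconnected_of_mem_cycles hz).subset_or_subset (u := u)
            (F₁ := {x | x ∈ e :: β}) (F₂ := {x | x ∈ p ++ f :: q})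
            (by rw [← setOf_mem_split]; exact hzw) (by
              rw [hβ.vertsOf_eq, hr.vertsOf_eq]
              exact fun x hx => h7 x hx.1 hx.2)
          rcases hor with hor | hor
          · exact Or.inl (eq_of_cycles_subset hz hβc hor)
          · exact Or.inr ⟨hz, hor⟩
        · rintro (rfl | ⟨hz, hzr⟩)
          · refine ⟨hβc, fun x hx => ?_⟩
            have hx' : x ∈ e :: β := hx
            exact List.mem_append_right _ (List.mem_append_left _ hx')
          · exact ⟨hz, fun x hx => hsub.subset (hzr x hx)⟩
      obtain ⟨l, hl, hlw⟩ := hr.exists_rotation (e := f) (by simp)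
      obtain ⟨c, hcl, hc0, hcw, hcn⟩ := hlw.exists_cycle (by simp)
      have hcc : (c : Cycle E) ∈ D.cyclesIn (p ++ f :: q) :=
        ⟨mem_cycles_of_isWalk hc0 hcw hcn, fun x hx => hl.mem_iff.2 (hcl.subset hx)⟩
      have huc : u ∈ D.circuitVerts (c : Cycle E) :=
        (mem_circuitVerts (isClosedTrail_iff.2 ⟨hc0, hcn.of_map, _, hcw⟩)).2
          (h4 ▸ hcw.start_mem hc0)
      rw [hins]
      refine (ih _ (by simp at hn ⊢; omega) hrt rfl).induce_insert hnot hcc ⟨?_, u, ?_, huc⟩ ?_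
      · exact fun heq => hnot (heq ▸ hcc)
      · exact (mem_circuitVerts hβ).2 (by simp [h3])
      · rintro x hx ⟨-, v, hv, hvx⟩
        have hvu : v = u := hverts v hv (hin x hx v hvx)
        subst hvu
        obtain ⟨g, hg, hgu⟩ := exists_src_of_mem_circuitVerts hx.1 hvx
        obtain ⟨k, hk, hku⟩ := exists_src_of_mem_circuitVerts hcc.1 huc
        have hgf : g = f := ht.eq_of_src_eq h3 h4 (hx.2 g hg) hgu
        have hkf : k = f := ht.eq_of_src_eq h3 h4 (hcc.2 k hk) hku
        exact (inCycleClosure_of_noncrossing hr hrt.2.2).eq_of_mem_of_mem hx.1 hcc.1 hx.2 hcc.2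
          (hgf ▸ hg) (hkf ▸ hk)

theorem IsTreelike.isTree_cycleIntersectionGraph {w : List E} (h : D.IsTreelike w)
    (hw : ∀ e, e ∈ w) : D.cycleIntersectionGraph.IsTree := by
  have h' := h.isTree
  have : D.cyclesIn w = D.cycles := by
    ext z
    exact ⟨fun h => h.1, fun h => ⟨h, fun e _ => hw e⟩⟩
  rw [this] at h'
  have heq : D.circuitIntersectionGraph.induce D.cycles = D.cycleIntersectionGraph := by
    ext z z'
    exact and_congr_left fun _ => Subtype.coe_ne_coe
  exact heq ▸ h'

/-! ### An acyclic intersection graph forces closed trails to be treelike. -/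

/-- Three distinct cycles through a vertex form a triangle of the intersection graph. -/
theorem not_isAcyclic_of_three_cycles {z₁ z₂ z₃ : Cycle E} {v : V} (h₁ : z₁ ∈ D.cycles)
    (h₂ : z₂ ∈ D.cycles) (h₃ : z₃ ∈ D.cycles) (h₁₂ : z₁ ≠ z₂) (h₁₃ : z₁ ≠ z₃) (h₂₃ : z₂ ≠ z₃)
    (hv₁ : v ∈ D.circuitVerts z₁) (hv₂ : v ∈ D.circuitVerts z₂) (hv₃ : v ∈ D.circuitVerts z₃) :
    ¬ D.cycleIntersectionGraph.IsAcyclic := by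
  classical
  intro h
  refine h.cliqueFree le_rfl {(⟨z₁, h₁⟩ : D.cycles), ⟨z₂, h₂⟩, ⟨z₃, h₃⟩} ?_
  rw [SimpleGraph.is3Clique_triple_iff]
  exact ⟨⟨fun h => h₁₂ (congrArg Subtype.val h), v, hv₁, hv₂⟩,
    ⟨fun h => h₁₃ (congrArg Subtype.val h), v, hv₁, hv₃⟩,
    ⟨fun h => h₂₃ (congrArg Subtype.val h), v, hv₂, hv₃⟩⟩

theorem IsWalk.exists_mem_cycles {a : V} {l : List E} (h : D.IsWalk a l a) (hl : l ≠ []) :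
    ∃ z ∈ D.cycles, a ∈ D.circuitVerts z ∧ ∀ e ∈ z, e ∈ l := by
  obtain ⟨c, hc, hc0, hcw, hcn⟩ := h.exists_cycle hl
  refine ⟨c, mem_cycles_of_isWalk hc0 hcw hcn, ?_, fun e he => hc.subset he⟩
  exact (mem_circuitVerts (isClosedTrail_iff.2 ⟨hc0, hcn.of_map, _, hcw⟩)).2 (hcw.start_mem hc0)

theorem IsWalk.split_map {x y a : V} {w : List E} (h : D.IsWalk x w y) {L₁ L₂ : List V}
    (hm : w.map D.src = L₁ ++ a :: L₂) :
    ∃ w₁ w₂, w = w₁ ++ w₂ ∧ w₁.map D.src = L₁ ∧ w₂.map D.src = a :: L₂ ∧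
      D.IsWalk x w₁ a ∧ D.IsWalk a w₂ y := by
  obtain ⟨w₁, w₂, rfl, h₁, h₂⟩ := List.map_eq_append_iff.1 hm
  obtain ⟨b, hb₁, hb₂⟩ := isWalk_append_iff.1 h
  refine ⟨w₁, w₂, rfl, h₁, h₂, ?_⟩
  obtain ⟨e, l, rfl, he, -⟩ := List.map_eq_cons_iff.1 h₂
  have : b = a := hb₂.1.symm.trans he
  exact this ▸ ⟨hb₁, hb₂⟩

theorem exists_split_of_cons_sublist {α : Type*} {a : α} {s l : List α}
    (h : (a :: s).Sublist l) : ∃ p q, l = p ++ a :: q ∧ a ∉ p ∧ s.Sublist q := by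
  obtain ⟨r₁, r₂, rfl, ha, hs⟩ := List.cons_sublist_iff.1 h
  obtain ⟨p, t, rfl, hp⟩ := List.eq_append_cons_of_mem ha
  exact ⟨p, t ++ r₂, by simp, hp, hs.trans (List.sublist_append_right _ _)⟩

theorem ne_nil_of_map_eq_cons {α β : Type*} {f : α → β} {l : List α} {b : β} {L : List β}
    (h : l.map f = b :: L) : l ≠ [] := by
  rintro rfl
  simp at h

theorem exists_mem_of_mem_cycles {z : Cycle E} (hz : z ∈ D.cycles) : ∃ e, e ∈ z :=
  (isBiconnected_of_mem_cycles hz).1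

theorem ne_of_disjoint_of_mem_cycles {z z' : Cycle E} (hz : z ∈ D.cycles) {l l' : List E}
    (hl : ∀ e ∈ z, e ∈ l) (hl' : ∀ e ∈ z', e ∈ l') (hd : l.Disjoint l') : z ≠ z' := by
  rintro rfl
  obtain ⟨e, he⟩ := exists_mem_of_mem_cycles hz
  exact hd (hl e he) (hl' e he)

theorem IsClosedTrail.rotate_to {w : List E} (h : D.IsClosedTrail w) {a : V} {p q : List V}
    (hm : w.map D.src = p ++ a :: q) :
    ∃ w', w ~r w' ∧ D.IsWalk a w' a ∧ w'.map D.src = a :: (q ++ p) := by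
  obtain ⟨-, -, x, hx⟩ := isClosedTrail_iff.1 h
  obtain ⟨w₁, w₂, rfl, h1, h2, h3, h4⟩ := hx.split_map hm
  exact ⟨w₂ ++ w₁, List.isRotated_append, h4.append h3, by simp [h1, h2]⟩

/-- Three visits to `a` cut the trail into three edge-disjoint closed walks, each containing a cycle
through `a`. -/
theorem atMostTwice_of_isAcyclic (h : D.cycleIntersectionGraph.IsAcyclic) {w : List E}
    (hw : D.IsClosedTrail w) : AtMostTwice (w.map D.src) := by
  intro a ha
  obtain ⟨p₀, q₀, hm, -, ha⟩ := exists_split_of_cons_sublist ha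
  obtain ⟨w', hr, hwalk, hm'⟩ := hw.rotate_to hm
  obtain ⟨p₁, q₁, rfl, -, ha⟩ := exists_split_of_cons_sublist ha
  obtain ⟨p₂, q₂, rfl, -, -⟩ := exists_split_of_cons_sublist ha
  obtain ⟨P, w₁, rfl, hP, hw₁, hPw, hw₁w⟩ := hwalk.split_map (a := a) (L₁ := a :: p₁)
    (L₂ := p₂ ++ a :: q₂ ++ p₀) (by simpa using hm')
  obtain ⟨Q, R, rfl, hQ, hR, hQw, hRw⟩ := hw₁w.split_map (a := a) (L₁ := a :: p₂)
    (L₂ := q₂ ++ p₀) (by simpa using hw₁)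
  have hnd := hr.nodup_iff.1 hw.2.1
  have hd₁ := List.disjoint_of_nodup_append hnd
  have hd₂ := List.disjoint_of_nodup_append (List.Nodup.of_append_right hnd)
  rw [List.disjoint_append_right] at hd₁
  obtain ⟨z₁, hz₁, hv₁, hs₁⟩ := hPw.exists_mem_cycles (ne_nil_of_map_eq_cons hP)
  obtain ⟨z₂, hz₂, hv₂, hs₂⟩ := hQw.exists_mem_cycles (ne_nil_of_map_eq_cons hQ)
  obtain ⟨z₃, hz₃, hv₃, hs₃⟩ := hRw.exists_mem_cycles (ne_nil_of_map_eq_cons hR)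
  exact not_isAcyclic_of_three_cycles hz₁ hz₂ hz₃
    (ne_of_disjoint_of_mem_cycles hz₁ hs₁ hs₂ hd₁.1)
    (ne_of_disjoint_of_mem_cycles hz₁ hs₁ hs₃ hd₁.2)
    (ne_of_disjoint_of_mem_cycles hz₂ hs₂ hs₃ hd₂) hv₁ hv₂ hv₃ h

/-- A crossing cuts the trail into segments `P`, `Q`, `R`, `S` running alternately from `a` to `b`
and from `b` to `a`. The closed walks `P ++ Q`, `R ++ S` and `P ++ S` contain three distinct cycles
through `a`. -/
theorem noncrossing_of_isAcyclic (h : D.cycleIntersectionGraph.IsAcyclic) {w : List E}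
    (hw : D.IsClosedTrail w) : Noncrossing (w.map D.src) := by
  intro a b hab hs
  obtain ⟨p₀, q₀, hm, -, hs⟩ := exists_split_of_cons_sublist hs
  obtain ⟨w', hr, hwalk, hm'⟩ := hw.rotate_to hm
  have htwo := (atMostTwice_of_isAcyclic h hw).of_perm (hr.map D.src).perm
  obtain ⟨p₁, q₁, rfl, -, hs⟩ := exists_split_of_cons_sublist hs
  obtain ⟨p₂, q₂, rfl, -, hs⟩ := exists_split_of_cons_sublist hs
  obtain ⟨p₃, q₃, rfl, -, -⟩ := exists_split_of_cons_sublist hs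
  obtain ⟨P, w₁, rfl, hP, hw₁, hPw, hw₁w⟩ := hwalk.split_map (a := b) (L₁ := a :: p₁)
    (L₂ := p₂ ++ a :: (p₃ ++ b :: q₃) ++ p₀) (by simpa using hm')
  obtain ⟨Q, w₂, rfl, hQ, hw₂, hQw, hw₂w⟩ := hw₁w.split_map (a := a) (L₁ := b :: p₂)
    (L₂ := p₃ ++ b :: q₃ ++ p₀) (by simpa using hw₁)
  obtain ⟨R, S, rfl, hR, hS, hRw, hSw⟩ := hw₂w.split_map (a := b) (L₁ := a :: p₃)
    (L₂ := q₃ ++ p₀) (by simpa using hw₂)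
  rw [hm'] at htwo
  -- The starts of `P` and `R` are already the two permitted visits to `a`. Hence no edge of `P`
  -- enters `a` and no edge of `S` leaves it.
  have hap : a ∉ p₁ ∧ a ∉ q₃ ++ p₀ := by
    classical
    have := atMostTwice_iff_count.1 htwo a
    simp only [List.count_append, List.count_cons_self] at this
    constructor <;> intro hc <;> have := List.count_pos_iff.2 hc <;>
      simp only [List.count_append, List.count_cons_of_ne hab.symm, List.count_cons_self] at * <;>
      omega
  have hPt : ∀ f ∈ P, D.tgt f ≠ a := by
    obtain ⟨e, P', rfl, he, hP'⟩ := List.map_eq_cons_iff.1 hP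
    intro f hf hfa
    have : D.tgt f = b ∨ D.tgt f ∈ P'.map D.src := by
      rcases List.mem_cons.1 hf with rfl | hf
      · by_cases h0 : P' = []
        · subst h0
          exact Or.inl hPw.2
        · exact Or.inr (hPw.2.start_mem h0)
      · exact hPw.2.tgt_mem hf
    rw [hfa, hP'] at this
    exact this.elim hab hap.1
  have hSs : ∀ f ∈ S, D.src f ≠ a := by
    intro f hf hfa
    have := List.mem_map_of_mem (f := D.src) hf
    rw [hS, hfa] at this
    exact (List.mem_cons.1 this).elim hab hap.2
  have hnd := hr.nodup_iff.1 hw.2.1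
  have hd₁ := List.disjoint_of_nodup_append hnd
  have hd₂ := List.disjoint_of_nodup_append (List.Nodup.of_append_right hnd)
  simp only [List.disjoint_append_right] at hd₁ hd₂
  obtain ⟨z₁, hz₁, hv₁, hs₁⟩ := (hPw.append hQw).exists_mem_cycles
    (by simp [ne_nil_of_map_eq_cons hP])
  obtain ⟨z₂, hz₂, hv₂, hs₂⟩ := (hRw.append hSw).exists_mem_cycles
    (by simp [ne_nil_of_map_eq_cons hR])
  -- The cycle in `P ++ S` enters `a` by an edge of `S` and leaves it by an edge of `P`, so it lies
  -- neither in `P ++ Q` nor in `R ++ S`.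
  obtain ⟨z₃, hz₃, hv₃, hs₃⟩ := (hPw.append hSw).exists_mem_cycles
    (by simp [ne_nil_of_map_eq_cons hP])
  refine not_isAcyclic_of_three_cycles hz₁ hz₂ hz₃ ?_ ?_ ?_ hv₁ hv₂ hv₃ h
  · refine ne_of_disjoint_of_mem_cycles hz₁ hs₁ hs₂ ?_
    simp only [List.disjoint_append_right, List.disjoint_append_left]
    exact ⟨⟨hd₁.2.1, hd₂.1⟩, hd₁.2.2, hd₂.2⟩
  · rintro rfl
    obtain ⟨f, hf, hfa⟩ := exists_tgt_of_mem_circuitVerts hz₁ hv₁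
    have hfS : f ∈ S := (List.mem_append.1 (hs₃ f hf)).resolve_left fun h' => hPt f h' hfa
    exact (List.mem_append.1 (hs₁ f hf)).elim (fun h' => hd₁.2.2 h' hfS) fun h' => hd₂.2 h' hfS
  · rintro rfl
    obtain ⟨f, hf, hfa⟩ := exists_src_of_mem_circuitVerts hz₂ hv₂
    have hfP : f ∈ P := (List.mem_append.1 (hs₃ f hf)).resolve_right fun h' => hSs f h' hfa
    exact (List.mem_append.1 (hs₂ f hf)).elim (fun h' => hd₁.2.1 hfP h') fun h' => hd₁.2.2 hfP h'

end MultiDigraph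

/-! ### Interlacing pairs and exchange of segments. -/

namespace MultiDigraph

variable {V E : Type*} {D : MultiDigraph V E}

theorem vertexSeq_eq_cons {x y : V} {w : List E} (h : D.IsWalk x w y) (hw : w ≠ []) :
    D.vertexSeq w = x :: w.map D.tgt := by
  obtain ⟨e, l, rfl⟩ := List.exists_cons_of_ne_nil hw
  rw [vertexSeq, h.1]

theorem vertexSeq_eq_append {x y : V} {w : List E} (h : D.IsWalk x w y) (hw : w ≠ []) :
    D.vertexSeq w = w.map D.src ++ [y] := by
  rw [vertexSeq_eq_cons h hw]
  clear hw
  induction w generalizing x with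
  | nil => rw [show x = y from h]; rfl
  | cons e l ih => simp [ih h.2, h.1]

theorem isInterlacingPairOfTrail_of_vertexSeq {w : List E} {a b : V} {p₀ p₁ p₂ p₃ p₄ : List V}
    (h : D.vertexSeq w = p₀ ++ a :: (p₁ ++ b :: (p₂ ++ a :: (p₃ ++ b :: p₄))))
    (h₁ : a ∉ p₁ ∧ b ∉ p₁) (h₂ : a ∉ p₂ ∧ b ∉ p₂) (h₃ : a ∉ p₃ ∧ b ∉ p₃) :
    D.IsInterlacingPairOfTrail w a b := by
  refine ⟨p₀.length, p₀.length + 1 + p₁.length, p₀.length + 1 + p₁.length + 1 + p₂.length,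
    p₀.length + 1 + p₁.length + 1 + p₂.length + 1 + p₃.length, by omega, by omega, by omega, ?_⟩
  rw [h]
  refine ⟨by simp, ?_, ?_, ?_, ?_⟩
  · rw [List.getElem?_append_right (by omega), List.getElem?_cons, if_neg (by omega),
      List.getElem?_append_right (by omega), List.getElem?_cons, if_pos (by omega)]
  · rw [List.getElem?_append_right (by omega), List.getElem?_cons, if_neg (by omega),
      List.getElem?_append_right (by omega), List.getElem?_cons, if_neg (by omega),
      List.getElem?_append_right (by omega), List.getElem?_cons, if_pos (by omega)]
  · rw [List.getElem?_append_right (by omega), List.getElem?_cons, if_neg (by omega),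
      List.getElem?_append_right (by omega), List.getElem?_cons, if_neg (by omega),
      List.getElem?_append_right (by omega), List.getElem?_cons, if_neg (by omega),
      List.getElem?_append_right (by omega), List.getElem?_cons, if_pos (by omega)]
  · intro j hj hj' hj₂ hj₃
    have key : ∀ x, (p₀ ++ a :: (p₁ ++ b :: (p₂ ++ a :: (p₃ ++ b :: p₄))))[j]? = some x →
        x ∈ p₁ ∨ x ∈ p₂ ∨ x ∈ p₃ := by
      intro x hx
      rw [List.getElem?_append_right (by omega), List.getElem?_cons, if_neg (by omega)] at hx
      by_cases c₁ : j < p₀.length + 1 + p₁.length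
      · rw [List.getElem?_append_left (by omega)] at hx
        exact Or.inl (List.mem_of_getElem? hx)
      rw [List.getElem?_append_right (by omega), List.getElem?_cons, if_neg (by omega)] at hx
      by_cases c₂ : j < p₀.length + 1 + p₁.length + 1 + p₂.length
      · rw [List.getElem?_append_left (by omega)] at hx
        exact Or.inr (Or.inl (List.mem_of_getElem? hx))
      rw [List.getElem?_append_right (by omega), List.getElem?_cons, if_neg (by omega),
        List.getElem?_append_left (by omega)] at hx
      exact Or.inr (Or.inr (List.mem_of_getElem? hx))
    constructor
    · intro hx
      rcases key a hx with h | h | h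
      exacts [h₁.1 h, h₂.1 h, h₃.1 h]
    · intro hx
      rcases key b hx with h | h | h
      exacts [h₁.2 h, h₂.2 h, h₃.2 h]

/-- A closed trail whose circuit has no interlacing pair is treelike. -/
theorem isTreelike_of_not_isInterlacingPair {w : List E} (hw : D.IsClosedTrail w)
    (h : ∀ a b : V, ¬ D.IsInterlacingPair (w : Cycle E) a b) : D.IsTreelike w := by
  have htwo : AtMostTwice (w.map D.src) := by
    intro a hs
    obtain ⟨p₀, q₀, hm, -, hs⟩ := exists_split_of_cons_sublist hs
    obtain ⟨w', hr, hwalk, hm'⟩ := hw.rotate_to hm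
    -- The pair `(a, a)` needs four visits. After rotation to `a`, the return to the starting vertex
    -- at the end of the vertex sequence supplies the fourth.
    have hs' : [a, a, a].Sublist (q₀ ++ p₀ ++ [a]) :=
      (hs.trans (List.sublist_append_left q₀ p₀)).append (List.Sublist.refl [a])
    obtain ⟨p₁, q₁, he, h1, hs'⟩ := exists_split_of_cons_sublist hs'
    obtain ⟨p₂, q₂, rfl, h2, hs'⟩ := exists_split_of_cons_sublist hs'
    obtain ⟨p₃, q₃, rfl, h3, -⟩ := exists_split_of_cons_sublist hs'
    refine h a a ⟨w', hw.of_isRotated hr, (Cycle.coe_eq_coe.2 hr).symm, ?_⟩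
    refine isInterlacingPairOfTrail_of_vertexSeq (p₀ := []) (p₁ := p₁) (p₂ := p₂) (p₃ := p₃)
      (p₄ := q₃) ?_ ⟨h1, h1⟩ ⟨h2, h2⟩ ⟨h3, h3⟩
    rw [vertexSeq_eq_append hwalk (ne_nil_of_map_eq_cons hm'), hm', List.nil_append, ← he]
    simp
  refine ⟨hw, htwo, fun a b hab hs => ?_⟩
  obtain ⟨hw0, -, y, hy⟩ := isClosedTrail_iff.1 hw
  obtain ⟨p₀, q₀, hm, -, hs⟩ := exists_split_of_cons_sublist hs
  obtain ⟨p₁, q₁, rfl, h1, hs⟩ := exists_split_of_cons_sublist hs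
  obtain ⟨p₂, q₂, rfl, h2, hs⟩ := exists_split_of_cons_sublist hs
  obtain ⟨p₃, q₃, rfl, h3, -⟩ := exists_split_of_cons_sublist hs
  rw [hm] at htwo
  -- Splitting at first occurrences excluded one of the two vertices from each gap; the bound of two
  -- visits excludes the other.
  have hnot : a ∉ p₁ ∧ b ∉ p₂ ∧ a ∉ p₃ := by
    classical
    have ha := atMostTwice_iff_count.1 htwo a
    have hb := atMostTwice_iff_count.1 htwo b
    simp only [List.count_append, List.count_cons_self, List.count_cons_of_ne hab,
      List.count_cons_of_ne hab.symm] at ha hb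
    refine ⟨?_, ?_, ?_⟩ <;> intro hc <;> have := List.count_pos_iff.2 hc <;> omega
  refine h a b ⟨w, hw, rfl, isInterlacingPairOfTrail_of_vertexSeq (p₀ := p₀) (p₁ := p₁)
    (p₂ := p₂) (p₃ := p₃) (p₄ := q₃ ++ [y]) ?_ ⟨hnot.1, h1⟩ ⟨h2, hnot.2.1⟩ ⟨hnot.2.2, h3⟩⟩
  rw [vertexSeq_eq_append hy hw0, hm]
  simp

theorem IsWalk.take {x y v : V} {w : List E} (h : D.IsWalk x w y) {i : ℕ}
    (hi : (x :: w.map D.tgt)[i]? = some v) : D.IsWalk x (w.take i) v := by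
  induction w generalizing x i with
  | nil =>
    cases i with
    | zero => simpa [IsWalk] using hi
    | succ i => simp at hi
  | cons e l ih =>
    cases i with
    | zero => simpa [IsWalk] using hi
    | succ i => exact ⟨h.1, ih h.2 (by simpa using hi)⟩

theorem IsWalk.exists_segment {x a b : V} {w : List E} {i j : ℕ} (hij : i < j)
    (hj : j ≤ w.length) (hi : D.IsWalk x (w.take i) a) (hj' : D.IsWalk x (w.take j) b) :
    ∃ P, P ≠ [] ∧ w.take j = w.take i ++ P ∧ D.IsWalk a P b := by
  obtain ⟨k, rfl⟩ := Nat.exists_eq_add_of_lt hij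
  have hk : w.take (i + k + 1) = w.take i ++ (w.drop i).take (k + 1) := by
    rw [add_assoc, List.take_add]
  refine ⟨(w.drop i).take (k + 1), ?_, hk, ?_⟩
  · intro h0
    have := congrArg List.length h0
    simp only [List.length_take, List.length_drop, List.length_nil] at this
    omega
  · rw [hk] at hj'
    obtain ⟨c, hc, hc'⟩ := isWalk_append_iff.1 hj'
    rwa [← hi.end_unique hc] at hc'

/-- With both lists rotated to begin with `P`, equality would force `Q ++ R ++ S = S ++ R ++ Q`, so
the first entry of `Q` would recur in `S`, or in `R` if `S` is empty. -/
theorem not_isRotated_swap {α : Type*} {P Q R S : List α} (hP : P ≠ []) (hQ : Q ≠ [])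
    (hR : R ≠ []) (hnd : (P ++ Q ++ R ++ S).Nodup) :
    ¬ (P ++ Q ++ R ++ S) ~r (R ++ Q ++ P ++ S) := by
  intro h
  have h' : (P ++ Q ++ R ++ S) ~r (P ++ (S ++ (R ++ Q))) := by
    refine h.trans ?_
    simpa using List.isRotated_append (l := R ++ Q) (l' := P ++ S)
  obtain ⟨x, P, rfl⟩ := List.exists_cons_of_ne_nil hP
  have heq : P ++ (Q ++ (R ++ S)) = P ++ (S ++ (R ++ Q)) := by
    refine eq_of_isRotated_of_head (x := x) ?_ ?_
    · simpa using hnd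
    · simpa using h'
  have heq := List.append_cancel_left heq
  obtain ⟨y, Q, rfl⟩ := List.exists_cons_of_ne_nil hQ
  have hnd' : ((y :: Q) ++ (R ++ S)).Nodup := by
    have : ((x :: P) ++ ((y :: Q) ++ (R ++ S))).Nodup := by simpa using hnd
    exact this.of_append_right
  have hy : y ∈ R ++ S := by
    cases S with
    | nil =>
      obtain ⟨z, R, rfl⟩ := List.exists_cons_of_ne_nil hR
      simp only [List.cons_append, List.nil_append] at heq
      simp [(List.cons.inj heq).1]
    | cons z S =>
      simp only [List.cons_append] at heq
      simp [(List.cons.inj heq).1]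
  exact List.disjoint_of_nodup_append hnd' List.mem_cons_self hy

/-- The Eulerian circuit obtained by exchanging two segments at an interlacing pair. -/
theorem IsInterlacingPairOfTrail.exists_ne {w : List E} {a b : V} (hw : D.IsEulerianTrail w)
    (h : D.IsInterlacingPairOfTrail w a b) :
    ∃ w', D.IsEulerianTrail w' ∧ ¬ w ~r w' := by
  obtain ⟨i₁, i₂, i₃, i₄, h12, h23, h34, h1, h2, h3, h4, -⟩ := h
  obtain ⟨hw0, hnd, x, hx⟩ := isClosedTrail_iff.1 hw.1
  rw [vertexSeq_eq_cons hx hw0] at h1 h2 h3 h4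
  have hlen : i₄ ≤ w.length := by
    obtain ⟨h, -⟩ := List.getElem?_eq_some_iff.1 h4
    simp at h
    omega
  -- `P` and `R` both run from `a` to `b`, so exchanging them around `Q` again gives a closed walk
  -- with the same edges, also when `a = b`.
  obtain ⟨P, hP, hP', hPw⟩ := IsWalk.exists_segment h12 (by omega) (hx.take h1) (hx.take h2)
  obtain ⟨Q, hQ, hQ', hQw⟩ := IsWalk.exists_segment h23 (by omega) (hx.take h2) (hx.take h3)
  obtain ⟨R, hR, hR', hRw⟩ := IsWalk.exists_segment h34 hlen (hx.take h3) (hx.take h4)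
  have hw₁ := hx.take h1
  have hw₄ := hx.take h4
  have hsplit : w.take i₁ ++ P ++ Q ++ R ++ w.drop i₄ = w := by
    rw [← hP', ← hQ', ← hR', List.take_append_drop]
  have hpost : D.IsWalk b (w.drop i₄) x := by
    rw [← List.take_append_drop i₄ w] at hx
    obtain ⟨c, hc, hc'⟩ := isWalk_append_iff.1 hx
    rwa [← hw₄.end_unique hc] at hc'
  generalize w.take i₁ = A at *
  generalize w.drop i₄ = B at *
  have hperm : (A ++ R ++ Q ++ P ++ B).Perm w := by
    classical
    rw [← hsplit, List.perm_iff_count]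
    intro e
    simp only [List.count_append]
    omega
  refine ⟨A ++ R ++ Q ++ P ++ B, ⟨isClosedTrail_iff.2 ⟨?_, hperm.nodup_iff.2 hnd, x, ?_⟩,
    fun e => hperm.mem_iff.2 (hw.2 e)⟩, fun hr => ?_⟩
  · intro h0
    simp [hR] at h0
  · exact (((hw₁.append hRw).append hQw).append hPw).append hpost
  · have hr1 : w ~r (P ++ Q ++ R ++ (B ++ A)) := by
      rw [← hsplit]
      simpa using List.isRotated_append (l := A) (l' := P ++ Q ++ R ++ B)
    have hr2 : (A ++ R ++ Q ++ P ++ B) ~r (R ++ Q ++ P ++ (B ++ A)) := by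
      simpa using List.isRotated_append (l := A) (l' := R ++ Q ++ P ++ B)
    exact not_isRotated_swap hP hQ hR (hr1.nodup_iff.1 hnd) (hr1.symm.trans (hr.trans hr2))

end MultiDigraph

/-! ### Assembly of the equivalences. -/

theorem mainTheorem2 {V E : Type*} [Finite V] [Finite E] [Nonempty E] (D : MultiDigraph V E)
    (hD : ∀ v : V, ∃ e : E, D.src e = v ∨ D.tgt e = v) :
    List.TFAE
      [ D.IsBridgelessCactus ∧ D.maxOutDegree ≤ 2,
        D.IsBridgelessChristmasCactus,
        ∃! z : Cycle E, z ∈ D.eulerianCircuits,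
        ∃ z ∈ D.eulerianCircuits, ∀ a b : V, ¬ D.IsInterlacingPair z a b ] ∧
    (D.IsEulerian → List.TFAE
      [ D.IsBridgelessCactus ∧ D.maxOutDegree ≤ 2,
        D.IsBridgelessChristmasCactus,
        D.cycleIntersectionGraph.IsTree,
        ∃! z : Cycle E, z ∈ D.eulerianCircuits,
        ∃ z ∈ D.eulerianCircuits, ∀ a b : V, ¬ D.IsInterlacingPair z a b ]) := by
  have : Nonempty V := ‹Nonempty E›.map D.src
  have h12 : (D.IsBridgelessCactus ∧ D.maxOutDegree ≤ 2) ↔ D.IsBridgelessChristmasCactus :=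
    MultiDigraph.christmasCactus_iff
  have htree : ∀ w : List E, D.IsTreelike w → (∀ e, e ∈ w) →
      D.IsBridgelessCactus ∧ D.maxOutDegree ≤ 2 := by
    intro w hw hall
    have huniv : {e | e ∈ w} = Set.univ := Set.eq_univ_of_forall hall
    refine ⟨⟨huniv ▸ MultiDigraph.inCycleClosure_of_noncrossing hw.1 hw.2.2, ?_⟩,
      MultiDigraph.maxOutDegree_le_of_atMostTwice hall hw.2.1⟩
    refine Set.eq_univ_of_forall fun v => ?_
    obtain ⟨e, he⟩ := hD v
    exact ⟨e, Set.mem_univ e, he⟩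
  have hcactus : D.IsBridgelessCactus ∧ D.maxOutDegree ≤ 2 →
      ∃ w : List E, D.IsTreelike w ∧ ∀ e, e ∈ w := by
    rintro ⟨hS, hdeg⟩
    obtain ⟨w, hw, huniv, hc⟩ := hS.1.exists_noncrossing
    exact ⟨w, ⟨hw, MultiDigraph.atMostTwice_of_outDegree hdeg hw.2.1, hc⟩,
      fun e => (Set.ext_iff.1 huniv e).2 (Set.mem_univ e)⟩
  have h14 : D.IsBridgelessCactus ∧ D.maxOutDegree ≤ 2 →
      ∃! z : Cycle E, z ∈ D.eulerianCircuits := by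
    intro h
    obtain ⟨w, hw, hall⟩ := hcactus h
    exact hw.existsUnique_eulerianCircuit hall
  have h45 : (∃! z : Cycle E, z ∈ D.eulerianCircuits) →
      ∃ z ∈ D.eulerianCircuits, ∀ a b : V, ¬ D.IsInterlacingPair z a b := by
    rintro ⟨z, hz, huniq⟩
    refine ⟨z, hz, ?_⟩
    rintro a b ⟨w, hw, rfl, hab⟩
    obtain ⟨w₀, hw₀, hr⟩ := hz
    have hall : ∀ e, e ∈ w := fun e => (Cycle.coe_eq_coe.1 hr).mem_iff.1 (hw₀.2 e)
    obtain ⟨w', hw', hne⟩ := hab.exists_ne ⟨hw, hall⟩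
    exact hne (Cycle.coe_eq_coe.1 (huniq _ ⟨w', hw', rfl⟩)).symm
  have h51 : (∃ z ∈ D.eulerianCircuits, ∀ a b : V, ¬ D.IsInterlacingPair z a b) →
      D.IsBridgelessCactus ∧ D.maxOutDegree ≤ 2 := by
    rintro ⟨_, ⟨w, hw, rfl⟩, h⟩
    exact htree w (MultiDigraph.isTreelike_of_not_isInterlacingPair hw.1 h) hw.2
  refine ⟨?_, fun hE => ?_⟩
  · tfae_have 1 ↔ 2 := h12
    tfae_have 1 → 3 := h14
    tfae_have 3 → 4 := h45
    tfae_have 4 → 1 := h51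
    tfae_finish
  · tfae_have 1 ↔ 2 := h12
    tfae_have 1 → 4 := h14
    tfae_have 4 → 5 := h45
    tfae_have 5 → 1 := h51
    tfae_have 1 → 3 := by
      intro h
      obtain ⟨w, hw, hall⟩ := hcactus h
      exact hw.isTree_cycleIntersectionGraph hall
    tfae_have 3 → 1 := by
      intro h
      -- Acyclicity makes every closed trail treelike; the Eulerian hypothesis supplies one that
      -- uses all edges.
      obtain ⟨_, w, hw, -⟩ := hE
      exact htree w ⟨hw.1, MultiDigraph.atMostTwice_of_isAcyclic h.2 hw.1,
        MultiDigraph.noncrossing_of_isAcyclic h.2 hw.1⟩ hw.2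
    tfae_finish
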